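/- Let $p$ be a prime, let $T$ be a finite extension of the field $\mathbb{Q}_p$ of $p$-adic numbers, $R$ its ring of integers, $F$ a field containing $R$, and $G=\langle a\mid a^p=1\rangle$ the cyclic group of order $p$. For an $RG$-module $M$ that is free of finite rank over $R$, put $FM=F\otimes_R M$ and $\widehat M=FM/M$ (additive groups with $G$-action). For a $1$-cocycle $f:G\to\widehat M$ (i.e. $f(gh)=g f(h)+f(g)$) let $\mathfrak{Crys}(G,M,f)$ be the group of all symbols $[g,x]$ with $g\in G$, $x\in FM$, $x\in f(g)$, multiplied like the matrices $\left(\begin{smallmatrix} g&x\\0&1\end{smallmatrix}\right)$, i.e. $[g,x][h,y]=[gh,x+gy]$. Its dimension is the $R$-rank of $M$. It is non-split if the class of $f$ in $H^1(G,\widehat M)$ is nonzero, and indecomposable if $M$ is an indecomposable $RG$-module and $f$ is not cohomologous to zero. Suppose that $\Phi_p(x)=x^{p-1}+\dots+x+1$ is a product $\eta_1(x)\cdots\eta_k(x)$ of $k\ge 3$ monic polynomials irreducible over $R$. Then: (a) The dimensions of the non-split indecomposable groups $\mathfrak{Crys}(G,M,f)$ are unbounded. (b) Let $\eta_1(x)=x^n-\alpha_{n-1}x^{n-1}-\dots-\alpha_1x-\alpha_0$,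 and let $\varepsilon$ be a primitive $p$-th root of unity in an algebraic closure of $T$ with $\eta_1(\varepsilon)=0$. Let $r_2,r_3$ be natural numbers such that $\eta_2(\varepsilon^{r_2})=0$ and $\eta_3(\varepsilon^{r_3})=0$. Let $\widetilde\varepsilon$ be the companion matrix of $\eta_1$ (ones below the diagonal, last column $(\alpha_0,\dots,\alpha_{n-1})^T$), let $u=(0,\dots,0,1)$ be a row of length $n$, let $\overline u$ be the $n\times n$ matrix with first row $u$ and all other rows zero, let $E_m$ be the identity matrix of degree $m$, and let $J_m(1)$ be the upper triangular Jordan block of degree $m$ with eigenvalue $1$. Then for every $m\ge 1$ $$\Gamma_m:\quad a\mapsto\begin{pmatrix}E_m&0&E_m\otimes u&J_m(1)\otimes u\\0&E_m\otimes\widetilde\varepsilon&E_m\otimes\overline u&E_m\otimes\overline u\\0&0&E_m\otimes\widetilde\varepsilon^{\,r_2}&0\\0&0&0&E_m\otimes\widetilde\varepsilon^{\,r_3}\end{pmatrix}$$ defines an indecomposable $R$-representation of $G$ of degree $(3n+1)m$, and $H^1(G,\widehat{\mathfrak W}_m)\ne 0$ for the module $\mathfrak W_m=R^{(3n+1)m}$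 affording $\Gamma_m$. -/

import Mathlib

open Polynomial
open scoped TensorProduct Kronecker

universe u

noncomputable section

/-! ### Indecomposable representations -/

/-- The module of the `R`-representation `ρ` of `G` is an indecomposable `RG`-module: it is nonzero,
and it is not the direct sum of two nonzero `G`-stable submodules. -/
def IsIndecomposableRep {R G M : Type*} [CommRing R] [Group G] [AddCommGroup M] [Module R M]
    (ρ : Representation R G M) : Prop :=
  Nontrivial M ∧ ∀ A B : Submodule R M, (∀ g, A ≤ A.comap (ρ g)) → (∀ g, B ≤ B.comap (ρ g)) →
    IsCompl A B → A = ⊥ ∨ B = ⊥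

/-! ### The modules `FM = F ⊗ M` and `FM / M` -/

section Hat

variable {R G M : Type*} (F : Type*) [CommRing R] [Group G] [Field F] [Algebra R F]
  [AddCommGroup M] [Module R M]

/-- The representation of `G` on `FM = F ⊗[R] M` given by `g (c ⊗ x) = c ⊗ g x`. -/
def extRep (ρ : Representation R G M) : Representation R G (F ⊗[R] M) :=
  (Representation.trivial R G F).tprod ρ

variable (R M) in
/-- The image of `M` in `FM`. -/
def latticeInExt : Submodule R (F ⊗[R] M) :=
  LinearMap.range (TensorProduct.mk R F M 1)

theorem latticeInExt_le_comap (ρ : Representation R G M) (g : G) :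
    latticeInExt R M F ≤ (latticeInExt R M F).comap (extRep F ρ g) := by
  rintro _ ⟨x, rfl⟩
  exact ⟨ρ g x, by simp [extRep]⟩

/-- The representation of `G` on `FM / M`. -/
def hatRep (ρ : Representation R G M) :
    Representation R G ((F ⊗[R] M) ⧸ latticeInExt R M F) :=
  (extRep F ρ).quotient (latticeInExt R M F) (latticeInExt_le_comap F ρ)

/-- The action of `G` by automorphisms on the additive group of `FM`, written multiplicatively. -/
def extAction (ρ : Representation R G M) : G →* MulAut (Multiplicative (F ⊗[R] M)) where
  toFun g := AddEquiv.toMultiplicative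
    { toFun := extRep F ρ g
      invFun := extRep F ρ g⁻¹
      left_inv := fun x => by simp
      right_inv := fun x => by simp
      map_add' := map_add _ }
  map_one' := by
    ext x
    exact congrArg (fun l => Multiplicative.ofAdd (l x.toAdd)) (map_one (extRep F ρ))
  map_mul' g h := by
    ext x
    exact congrArg (fun l => Multiplicative.ofAdd (l x.toAdd)) (map_mul (extRep F ρ) g h)

end Hat

/-! ### The groups `Crys(G, M, f)` -/

/-- The data `(M, f)` defining a group `Crys(G, M, f)`: an `RG`-module `M` which is free of finite
rank over `R`, and a 1-cocycle `f : G → FM / M`. -/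
structure CrysDatum (R G F : Type u) [CommRing R] [Group G] [Field F] [Algebra R F] where
  M : Type u
  [addCommGroup : AddCommGroup M]
  [module : Module R M]
  [free : Module.Free R M]
  [finite : Module.Finite R M]
  ρ : Representation R G M
  f : groupCohomology.cocycles₁ (Rep.of (hatRep F ρ))

namespace CrysDatum

attribute [instance] addCommGroup module free finite

variable {R G F : Type u} [CommRing R] [Group G] [Field F] [Algebra R F] (c : CrysDatum R G F)

/-- The group `Crys(G, M, f)` of all `[g, x]`, where `g ∈ G` and `x ∈ FM` lies in the coset `f g`,
with the multiplication `[g, x] [h, y] = [g h, x + g y]` of the matrices `(g x; 0 1)`. -/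
def Crys : Subgroup (Multiplicative (F ⊗[R] c.M) ⋊[extAction F c.ρ] G) where
  carrier := {s | (latticeInExt R c.M F).mkQ s.left.toAdd = c.f s.right}
  one_mem' := by
    have h := groupCohomology.cocycles₁_map_one c.f
    simp [h]
  mul_mem' {s t} hs ht := by
    have h := (groupCohomology.mem_cocycles₁_iff _).1 c.f.2 s.right t.right
    simp only [Set.mem_ofPred_eq] at hs ht ⊢
    refine Eq.trans ?_ h.symm
    change (latticeInExt R c.M F).mkQ (s.left.toAdd + extRep F c.ρ s.right t.left.toAdd) =
      hatRep F c.ρ s.right (c.f t.right) + c.f s.right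
    rw [map_add, hs, ← ht, add_comm]
    rfl
  inv_mem' {s} hs := by
    have h := groupCohomology.cocycles₁_map_inv c.f s.right⁻¹
    simp only [Set.mem_ofPred_eq] at hs ⊢
    rw [inv_inv] at h
    have h' : hatRep F c.ρ s.right⁻¹ (c.f s.right) = - c.f s.right⁻¹ := h
    change (latticeInExt R c.M F).mkQ (extRep F c.ρ s.right⁻¹ (-s.left.toAdd)) = c.f s.right⁻¹
    rw [map_neg, map_neg, eq_comm, ← neg_eq_iff_eq_neg, ← h', ← hs]
    rfl

/-- The dimension of `Crys(G, M, f)`: the `R`-rank of `M`. -/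
def dim : ℕ := Module.finrank R c.M

/-- `Crys(G, M, f)` is non-split: the class of `f` in `H¹(G, FM / M)` is nonzero. -/
def IsNonSplit : Prop := groupCohomology.H1π (Rep.of (hatRep F c.ρ)) c.f ≠ 0

/-- `Crys(G, M, f)` is indecomposable: `M` is an indecomposable `RG`-module and `f` is not
cohomologous to zero. -/
def IsIndecomposable : Prop :=
  IsIndecomposableRep c.ρ ∧ groupCohomology.H1π (Rep.of (hatRep F c.ρ)) c.f ≠ 0

end CrysDatum

/-! ### The matrices `Γ_m(a)` -/

section Gamma

variable {R : Type*} [CommRing R]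

/-- The companion matrix of `η = xⁿ - αₙ₋₁ xⁿ⁻¹ - ⋯ - α₀`, with last column `α₀, …, αₙ₋₁`. -/
def companionMatrix (η : R[X]) : Matrix (Fin η.natDegree) (Fin η.natDegree) R :=
  Matrix.of fun i j =>
    if j.val + 1 = η.natDegree then -η.coeff i.val else if i.val = j.val + 1 then 1 else 0

variable (R) in
/-- The row `u = (0, …, 0, 1)` of length `n`. -/
def rowU (n : ℕ) : Matrix (Fin 1) (Fin n) R :=
  Matrix.of fun _ j => if j.val + 1 = n then 1 else 0

variable (R) in
/-- The `n × n` matrix `ū` with first row `(0, …, 0, 1)` and all other rows zero. -/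
def matUbar (n : ℕ) : Matrix (Fin n) (Fin n) R :=
  Matrix.of fun i j => if i.val = 0 ∧ j.val + 1 = n then 1 else 0

variable (R) in
/-- The (upper triangular) Jordan block of degree `m` with `c` on the main diagonal. -/
def jordanBlock (m : ℕ) (c : R) : Matrix (Fin m) (Fin m) R :=
  Matrix.of fun i j => if i = j then c else if i.val + 1 = j.val then 1 else 0

/-- The index set of the rows and columns of `Γ_m(a)`. -/
abbrev GammaIndex (m n : ℕ) : Type :=
  (Fin m × Fin 1 ⊕ Fin m × Fin n) ⊕ (Fin m × Fin n ⊕ Fin m × Fin n)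

/-- The matrix `Γ_m(a)`, where `δ₀(a) = 1`, `δ₁(a)` is the companion matrix of `η`,
`δ₂(a) = δ₁(a) ^ r₂` and `δ₃(a) = δ₁(a) ^ r₃`. -/
def gammaMatrix (η : R[X]) (r₂ r₃ m : ℕ) :
    Matrix (GammaIndex m η.natDegree) (GammaIndex m η.natDegree) R :=
  let E : Matrix (Fin m) (Fin m) R := 1
  let Δ₁ := Matrix.fromBlocks (E ⊗ₖ (1 : Matrix (Fin 1) (Fin 1) R)) 0 0 (E ⊗ₖ companionMatrix η)
  let Δ₂ := Matrix.fromBlocks (E ⊗ₖ (companionMatrix η ^ r₂)) 0 0 (E ⊗ₖ (companionMatrix η ^ r₃))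
  let U := Matrix.fromBlocks (E ⊗ₖ rowU R η.natDegree) (jordanBlock R m 1 ⊗ₖ rowU R η.natDegree)
    (E ⊗ₖ matUbar R η.natDegree) (E ⊗ₖ matUbar R η.natDegree)
  Matrix.fromBlocks Δ₁ U 0 Δ₂

end Gamma

end

noncomputable section

/-! ### Idempotents commuting with nilpotent elements -/

theorem IsIdempotentElem.eq_zero_of_left_annihilator {S : Type*} [Ring S] {a b : S}
    (ha : IsIdempotentElem a) (hab : Commute a b) (hb : IsNilpotent b)
    (h : ∀ z, b * z = 0 → a * z = 0) : a = 0 := by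
  obtain ⟨k, hk⟩ := hb
  -- Descent on the exponent: if $b^{j+1}a=0$, the hypothesis with $z=b^ja$ gives $0=ab^ja=b^ja$.
  have key : ∀ j, b ^ j * a = 0 → a = 0 := by
    intro j
    induction j with
    | zero => simp
    | succ j ih =>
      intro hj
      refine ih ?_
      have h1 := h (b ^ j * a) (by rw [← mul_assoc, ← pow_succ', hj])
      rwa [← mul_assoc, (hab.pow_right j).eq, mul_assoc, ha.eq] at h1
  exact key k (by rw [hk, zero_mul])

theorem IsIdempotentElem.eq_zero_of_right_annihilator {S : Type*} [Ring S] {a b : S}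
    (ha : IsIdempotentElem a) (hab : Commute a b) (hb : IsNilpotent b)
    (h : ∀ z, z * b = 0 → z * a = 0) : a = 0 := by
  obtain ⟨k, hk⟩ := hb
  have key : ∀ j, a * b ^ j = 0 → a = 0 := by
    intro j
    induction j with
    | zero => simp
    | succ j ih =>
      intro hj
      refine ih ?_
      have h1 := h (a * b ^ j) (by rw [mul_assoc, ← pow_succ, hj])
      rwa [mul_assoc, ← (hab.pow_right j).eq, ← mul_assoc, ha.eq] at h1
  exact key k (by rw [hk, mul_zero])

/-! ### Matrices over a domain -/

/-- The determinant of $1-A$ maps to $1$, so it is nonzero; multiplying $(1-A)A=0$ by the adjugate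
then forces $A=0$ over a domain. -/
theorem Matrix.eq_zero_of_idempotent_of_map_eq_zero {R κ ι : Type*} [CommRing R] [IsDomain R]
    [CommRing κ] [Nontrivial κ] [Fintype ι] [DecidableEq ι] (φ : R →+* κ) {A : Matrix ι ι R}
    (hA : A * A = A) (h : A.map φ = 0) : A = 0 := by
  have hdet : (1 - A).det ≠ 0 := by
    intro h0
    have h1 := RingHom.map_det φ (1 - A)
    have h2 : φ.mapMatrix A = 0 := h
    rw [h0, map_zero, map_sub, map_one, h2, sub_zero, Matrix.det_one] at h1
    exact zero_ne_one h1
  have h3 : (1 - A) * A = 0 := by rw [sub_mul, one_mul, hA, sub_self]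
  have h4 : (1 - A).det • A = 0 := by
    have := congrArg ((1 - A).adjugate * ·) h3
    simpa [← Matrix.mul_assoc, Matrix.adjugate_mul] using this
  exact (smul_eq_zero.1 h4).resolve_left hdet

theorem Matrix.mul_aeval_of_intertwines {R α β : Type*} [CommRing R] [Fintype α] [DecidableEq α]
    [Fintype β] [DecidableEq β] {C : Matrix α β R} {A : Matrix β β R} {B : Matrix α α R}
    (h : C * A = B * C) (f : R[X]) : C * aeval A f = aeval B f * C := by
  induction f using Polynomial.induction_on' with
  | add f g hf hg => simp [Matrix.mul_add, Matrix.add_mul, hf, hg]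
  | monomial k r =>
    have : ∀ k : ℕ, C * A ^ k = B ^ k * C := by
      intro k
      induction k with
      | zero => simp
      | succ k ih => rw [pow_succ, ← Matrix.mul_assoc, ih, Matrix.mul_assoc, h, ← Matrix.mul_assoc,
          pow_succ]
    simp [aeval_monomial, Algebra.algebraMap_eq_smul_one, this]

/-- Separability of $X^p-1$ in explicit form: the constant $p$ lies in the ideal $(P,Q)$. Evaluated
through the intertwining relation, this gives $pC=0$. -/
theorem Matrix.eq_zero_of_intertwines {R α β : Type*} [CommRing R] [IsDomain R]
    [Fintype α] [DecidableEq α] [Fintype β] [DecidableEq β] {p : ℕ} (hp : (p : R) ≠ 0)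
    {P Q : R[X]} (hPQ : P * Q ∣ X ^ p - 1) {C : Matrix α β R} {A : Matrix β β R}
    {B : Matrix α α R} (h : C * A = B * C) (hA : aeval A P = 0) (hB : aeval B Q = 0) : C = 0 := by
  obtain ⟨H, hH⟩ := hPQ
  have hp0 : p ≠ 0 := by rintro rfl; simp at hp
  have hd := congrArg derivative hH
  simp only [derivative_sub, derivative_X_pow, derivative_one, sub_zero, derivative_mul] at hd
  have hX : (X : R[X]) ^ p = X ^ (p - 1) * X := by rw [← pow_succ, Nat.sub_add_cancel (by omega)]
  -- With $X^p-1=PQH$, this is the identity $p=X(X^p-1)'-p(X^p-1)$ sorted into multiples of $P$ and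
  -- of $Q$.
  have hid : (Polynomial.C (p : R)) = P * (X * (derivative Q * H + Q * derivative H)
      - Polynomial.C (p : R) * (Q * H)) + Q * (X * (derivative P * H)) := by
    linear_combination X * hd - Polynomial.C (p : R) * hH + Polynomial.C (p : R) * hX
  have h1 : C * aeval A (Polynomial.C (p : R)) = 0 := by
    rw [hid, map_add, map_mul, hA, zero_mul, zero_add, Matrix.mul_aeval_of_intertwines h, map_mul,
      hB, zero_mul, Matrix.zero_mul]
  rw [aeval_C, Algebra.algebraMap_eq_smul_one, Matrix.mul_smul, Matrix.mul_one] at h1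
  exact (smul_eq_zero.1 h1).resolve_left hp

theorem Matrix.exists_aeval_fromBlocks {R α β : Type*} [CommRing R] [Fintype α] [DecidableEq α]
    [Fintype β] [DecidableEq β] (A : Matrix α α R) (B : Matrix α β R) (D : Matrix β β R)
    (f : R[X]) : ∃ B', aeval (Matrix.fromBlocks A B 0 D) f =
      Matrix.fromBlocks (aeval A f) B' 0 (aeval D f) := by
  induction f using Polynomial.induction_on' with
  | add f g hf hg =>
    obtain ⟨B₁, h₁⟩ := hf
    obtain ⟨B₂, h₂⟩ := hg
    exact ⟨B₁ + B₂, by simp [h₁, h₂, Matrix.fromBlocks_add]⟩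
  | monomial k r =>
    have : ∀ k : ℕ, ∃ B', Matrix.fromBlocks A B 0 D ^ k = Matrix.fromBlocks (A ^ k) B' 0 (D ^ k) := by
      intro k
      induction k with
      | zero => exact ⟨0, by simp⟩
      | succ k ih =>
        obtain ⟨B', h⟩ := ih
        exact ⟨_, by rw [pow_succ, h, Matrix.fromBlocks_multiply]; simp [pow_succ]; rfl⟩
    obtain ⟨B', h⟩ := this k
    exact ⟨r • B', by
      simp [aeval_monomial, Algebra.algebraMap_eq_smul_one, h, Matrix.fromBlocks_smul]⟩

theorem Matrix.aeval_fromBlocks_diagonal {R α β : Type*} [CommRing R] [Fintype α] [DecidableEq α]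
    [Fintype β] [DecidableEq β] (A : Matrix α α R) (D : Matrix β β R)
    (f : R[X]) : aeval (Matrix.fromBlocks A 0 0 D) f =
      Matrix.fromBlocks (aeval A f) 0 0 (aeval D f) := by
  induction f using Polynomial.induction_on' with
  | add f g hf hg => simp [hf, hg, Matrix.fromBlocks_add]
  | monomial k r =>
    have : ∀ k : ℕ, Matrix.fromBlocks A 0 0 D ^ k = Matrix.fromBlocks (A ^ k) 0 0 (D ^ k) := by
      intro k
      induction k with
      | zero => simp
      | succ k ih => rw [pow_succ, ih, Matrix.fromBlocks_multiply]; simp [pow_succ]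
    simp [aeval_monomial, Algebra.algebraMap_eq_smul_one, this, Matrix.fromBlocks_smul]

/-- The algebra homomorphism `A ↦ 1 ⊗ₖ A`. -/
def Matrix.oneKroneckerAlgHom (R ι α : Type*) [CommRing R] [Fintype ι] [DecidableEq ι]
    [Fintype α] [DecidableEq α] : Matrix α α R →ₐ[R] Matrix (ι × α) (ι × α) R :=
  AlgHom.ofLinearMap
    { toFun := fun A => (1 : Matrix ι ι R) ⊗ₖ A
      map_add' := Matrix.kronecker_add _
      map_smul' := fun r A => Matrix.kronecker_smul r _ A } Matrix.one_kronecker_one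
    fun A B => by
      change (1 : Matrix ι ι R) ⊗ₖ (A * B) = (1 ⊗ₖ A) * (1 ⊗ₖ B)
      rw [← Matrix.mul_kronecker_mul, one_mul]

theorem Matrix.aeval_one_kronecker {R ι α : Type*} [CommRing R] [Fintype ι] [DecidableEq ι]
    [Fintype α] [DecidableEq α] (A : Matrix α α R) (f : R[X]) :
    aeval ((1 : Matrix ι ι R) ⊗ₖ A) f = (1 : Matrix ι ι R) ⊗ₖ (aeval A f) :=
  aeval_algHom_apply (Matrix.oneKroneckerAlgHom R ι α) A f

theorem Matrix.one_kronecker_pow {R ι α : Type*} [CommRing R] [Fintype ι] [DecidableEq ι]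
    [Fintype α] [DecidableEq α] (A : Matrix α α R) (k : ℕ) :
    ((1 : Matrix ι ι R) ⊗ₖ A) ^ k = (1 : Matrix ι ι R) ⊗ₖ (A ^ k) :=
  (map_pow (Matrix.oneKroneckerAlgHom R ι α) A k).symm

theorem Matrix.one_kronecker_mul_apply {R ι α β : Type*} [CommRing R] [Fintype ι] [DecidableEq ι]
    [Fintype α] {γ : Type*} (A : Matrix γ α R) (Z : Matrix (ι × α) β R) (k : ι) (i : γ) (b : β) :
    (((1 : Matrix ι ι R) ⊗ₖ A) * Z) (k, i) b = (A.mulVec fun j => Z (k, j) b) i := by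
  simp [Matrix.mul_apply, Fintype.sum_prod_type, Matrix.one_apply, Matrix.mulVec, dotProduct]

theorem Matrix.mul_one_kronecker_apply {R ι α β : Type*} [CommRing R] [Fintype ι] [DecidableEq ι]
    [Fintype α] {γ : Type*} (A : Matrix α γ R) (Z : Matrix β (ι × α) R) (k : ι) (i : γ) (b : β) :
    (Z * ((1 : Matrix ι ι R) ⊗ₖ A)) b (k, i) = (A.vecMul fun j => Z b (k, j)) i := by
  simp [Matrix.mul_apply, Fintype.sum_prod_type, Matrix.one_apply, Matrix.vecMul, dotProduct]

/-! ### Companion matrices -/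

/-- The companion matrix is the matrix of multiplication by the root in the power basis of
$R[X]/(\eta)$. -/
theorem aeval_companionMatrix {R : Type*} [CommRing R] [Nontrivial R] {η : R[X]} (hη : η.Monic) :
    aeval (companionMatrix η) η = 0 := by
  let pb := AdjoinRoot.powerBasis' hη
  have hgen : pb.gen = AdjoinRoot.root η := rfl
  have hmin : pb.minpolyGen = η := by
    refine (eq_of_monic_of_dvd_of_natDegree_le hη pb.minpolyGen_monic ?_ ?_)
    · have := pb.aeval_minpolyGen
      rwa [hgen, AdjoinRoot.aeval_eq, AdjoinRoot.mk_eq_zero] at this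
    · exact pb.natDegree_minpolyGen.le
  have h : Algebra.leftMulMatrix pb.basis pb.gen = companionMatrix η := by
    rw [pb.leftMulMatrix, hmin]
    rfl
  rw [← h]
  have h2 : aeval (Algebra.leftMulMatrix pb.basis pb.gen) η
    = Algebra.leftMulMatrix pb.basis (aeval pb.gen η) :=
      aeval_algHom_apply (Algebra.leftMulMatrix pb.basis) pb.gen η
  refine h2.trans ?_
  rw [hgen, AdjoinRoot.aeval_eq, AdjoinRoot.mk_self, map_zero]
  rfl

section Companion

variable {S : Type*} [CommRing S] (n : ℕ) (c : ℕ → S)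

/-- The companion matrix with last column `-c 0, …, -c (n - 1)`. -/
def companionOfCoeffs : Matrix (Fin n) (Fin n) S :=
  Matrix.of fun i j => if j.val + 1 = n then -c i.val else if i.val = j.val + 1 then 1 else 0

theorem companionMatrix_map {R : Type*} [CommRing R] (η : R[X]) (φ : R →+* S) :
    (companionMatrix η).map φ = companionOfCoeffs η.natDegree fun i => φ (η.coeff i) := by
  ext i j
  simp only [companionMatrix, companionOfCoeffs, Matrix.map_apply, Matrix.of_apply]
  split_ifs <;> simp

variable {n c}

/-- Away from its last column the companion matrix is a downward shift, so a fixed column with last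
entry $0$ has first entry $0$ and then $z_{i+1}=z_i$. A fixed column is thus determined by its last
entry. -/
theorem eq_zero_of_companionOfCoeffs_mulVec {z : Fin n → S}
    (hz : (companionOfCoeffs n c).mulVec z = z) (hl : ∀ j : Fin n, j.val + 1 = n → z j = 0) :
    z = 0 := by
  have key : ∀ (i : ℕ) (hi : i < n), z ⟨i, hi⟩ = 0 := by
    intro i
    induction i with
    | zero =>
      intro hi
      rw [← hz]
      refine (Finset.sum_eq_zero fun j _ => ?_ :
        ∑ j, companionOfCoeffs n c ⟨_, hi⟩ j * z j = 0)
      by_cases hj : j.val + 1 = n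
      · simp [hl j hj]
      · simp [companionOfCoeffs, hj]
    | succ i ih =>
      intro hi
      rw [← hz]
      refine (Finset.sum_eq_zero fun j _ => ?_ :
        ∑ j, companionOfCoeffs n c ⟨_, hi⟩ j * z j = 0)
      by_cases hj : j.val + 1 = n
      · simp [hl j hj]
      · by_cases hij : i = j.val
        · have : z j = 0 := by
            rw [← ih (by omega)]
            congr 1
            exact Fin.ext hij.symm
          simp [this]
        · simp [companionOfCoeffs, hj, hij]
  exact funext fun i => key i.1 i.2

/-- The fixed vector of a companion matrix of a polynomial vanishing at `1`. -/
def companionFixedVec (n : ℕ) (c : ℕ → S) : Fin n → S :=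
  fun i => -∑ j ∈ Finset.range (i.val + 1), c j

theorem companionFixedVec_last (hc : ∑ j ∈ Finset.range n, c j = -1) {j : Fin n}
    (hj : j.val + 1 = n) : companionFixedVec n c j = 1 := by
  rw [companionFixedVec, hj, hc, neg_neg]

theorem companionOfCoeffs_mulVec_fixed (hc : ∑ j ∈ Finset.range n, c j = -1) :
    (companionOfCoeffs n c).mulVec (companionFixedVec n c) = companionFixedVec n c := by
  ext i
  have hn : 0 < n := i.pos
  -- The last column meets the last coordinate, which is $1$ by `hc`; every other contribution is
  -- subdiagonal. Row $i$ then becomes the recursion $v_i=v_{i-1}-c_i$ for the negated partial sums.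
  have hterm : ∀ j : Fin n, companionOfCoeffs n c i j * companionFixedVec n c j =
      (if j = ⟨n - 1, by omega⟩ then -c i else 0) +
      (if i.val = j.val + 1 then companionFixedVec n c j else 0) := by
    intro j
    by_cases hj : j.val + 1 = n
    · have h1 : j = ⟨n - 1, by omega⟩ := Fin.ext (by simp; omega)
      have h2 : ¬ i.val = j.val + 1 := by omega
      rw [if_pos h1, if_neg h2, companionFixedVec_last hc hj]
      simp [companionOfCoeffs, hj]
    · have h1 : ¬ j = ⟨n - 1, by omega⟩ := fun h => hj (by rw [h]; simp; omega)
      rw [if_neg h1]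
      simp [companionOfCoeffs, hj]
  rw [Matrix.mulVec, dotProduct, Finset.sum_congr rfl fun j _ => hterm j, Finset.sum_add_distrib,
    Finset.sum_ite_eq' Finset.univ, if_pos (Finset.mem_univ _)]
  rcases Nat.eq_zero_or_pos i.val with hi | hi
  · rw [Finset.sum_eq_zero (fun j _ => if_neg (by omega))]
    simp [companionFixedVec, hi]
  · rw [Finset.sum_eq_single (⟨i.val - 1, by omega⟩ : Fin n)]
    · rw [if_pos (by simp; omega)]
      simp only [companionFixedVec]
      rw [Nat.sub_add_cancel hi, Finset.sum_range_succ _ i.val]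
      ring
    · intro j _ hj
      exact if_neg fun h => hj (Fin.ext (by simp; omega))
    · simp

theorem companionOfCoeffs_one_vecMul (hc : ∑ j ∈ Finset.range n, c j = -1) :
    (companionOfCoeffs n c).vecMul (fun _ => 1) = fun _ => 1 := by
  ext j
  simp only [Matrix.vecMul, dotProduct, one_mul, companionOfCoeffs, Matrix.of_apply]
  by_cases hj : j.val + 1 = n
  · simp only [hj, if_true, Finset.sum_neg_distrib]
    rw [Fin.sum_univ_eq_sum_range (fun i => c i), hc, neg_neg]
  · simp only [hj, if_false]
    rw [Finset.sum_eq_single (⟨j.val + 1, by omega⟩ : Fin n)]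
    · simp
    · intro i _ hi
      exact if_neg fun h => hi (Fin.ext h)
    · simp

theorem eq_of_companionOfCoeffs_vecMul {w : Fin n → S} (hw : (companionOfCoeffs n c).vecMul w = w)
    {i₀ : Fin n} (hi₀ : i₀.val = 0) (i : Fin n) : w i = w i₀ := by
  have key : ∀ (i : ℕ) (hi : i < n), w ⟨i, hi⟩ = w i₀ := by
    intro i
    induction i with
    | zero => intro hi; congr 1; exact Fin.ext hi₀.symm
    | succ i ih =>
      intro hi
      have hin : i + 1 ≠ n := by omega
      rw [← ih (by omega), ← congrFun hw ⟨i, by omega⟩]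
      simp only [Matrix.vecMul, dotProduct, companionOfCoeffs, Matrix.of_apply, hin, if_false]
      rw [Finset.sum_eq_single (⟨i + 1, by omega⟩ : Fin n)]
      · simp
      · intro j _ hj
        rw [if_neg fun h => hj (Fin.ext h), mul_zero]
      · simp
  exact key i.1 i.2

end Companion

/-! ### Idempotents commuting with a Jordan block -/

theorem isNilpotent_jordanBlock_sub_one {R : Type*} [CommRing R] (m : ℕ) :
    IsNilpotent (jordanBlock R m 1 - 1) := by
  have key : ∀ (k : ℕ) (i j : Fin m), j.val < i.val + k → ((jordanBlock R m 1 - 1) ^ k) i j = 0 := by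
    intro k
    induction k with
    | zero => exact fun i j h => Matrix.one_apply_ne (Fin.ne_of_gt h)
    | succ k ih =>
      intro i j h
      rw [pow_succ, Matrix.mul_apply]
      refine Finset.sum_eq_zero fun l _ => ?_
      by_cases hl : l.val + 1 = j.val
      · rw [ih i l (by omega), zero_mul]
      · by_cases hlj : l = j <;> simp [jordanBlock, hl, hlj]
  exact ⟨m, Matrix.ext fun i j => key m i j (by omega)⟩

theorem jordanBlock_sub_one_mul_apply {R : Type*} [CommRing R] {m : ℕ}
    (Z : Matrix (Fin m) (Fin m) R) (i : Fin m) (hi : i.val + 1 < m) (b : Fin m) :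
    ((jordanBlock R m 1 - 1) * Z) i b = Z ⟨i.val + 1, hi⟩ b := by
  rw [Matrix.mul_apply, Finset.sum_eq_single (⟨i.val + 1, hi⟩ : Fin m)]
  · simp [jordanBlock, Fin.ext_iff]
  · intro j _ hj
    have h1 : ¬ i.val + 1 = j.val := fun h => hj (Fin.ext h.symm)
    by_cases hij : i = j <;> simp [jordanBlock, h1, hij]
  · simp

theorem jordanBlock_sub_one_apply_zero {R : Type*} [CommRing R] {m : ℕ} (i j : Fin m)
    (hj : j.val = 0) : (jordanBlock R m 1 - 1) i j = 0 := by
  by_cases hij : i = j <;> simp [jordanBlock, hij, hj]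

theorem eq_zero_of_idempotent_of_commute_jordanBlock {R : Type*} [CommRing R] {m : ℕ}
    {x : Matrix (Fin m) (Fin m) R} (hx : x * x = x)
    (hJ : x * jordanBlock R m 1 = jordanBlock R m 1 * x)
    (h0 : ∀ i j : Fin m, j.val = 0 → x i j = 0) : x = 0 := by
  refine IsIdempotentElem.eq_zero_of_left_annihilator (b := jordanBlock R m 1 - 1) hx
    (Commute.sub_right hJ (Commute.one_right x)) (isNilpotent_jordanBlock_sub_one m) ?_
  intro z hz
  ext i b
  rw [Matrix.mul_apply]
  refine Finset.sum_eq_zero fun j _ => ?_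
  rcases Nat.eq_zero_or_pos j.val with hj | hj
  · rw [h0 i j hj, zero_mul]
  · have h1 := jordanBlock_sub_one_mul_apply z ⟨j.val - 1, by omega⟩ (by simp; omega) b
    have h2 : (⟨j.val - 1 + 1, by omega⟩ : Fin m) = j := Fin.ext (by simp; omega)
    rw [hz, h2] at h1
    rw [← h1, Matrix.zero_apply, mul_zero]

/-- The kernel of $N=J_m(1)-1$ is the line through the first basis vector, and $x$ preserves it,
acting by an idempotent scalar. If the scalar is $0$, then $x$ kills $\ker N$ and vanishes because
$N$ is nilpotent; if it is $1$, the same applies to $1-x$. -/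
theorem eq_zero_or_one_of_idempotent_of_commute_jordanBlock {R : Type*} [Field R]
    {m : ℕ} {x : Matrix (Fin m) (Fin m) R} (hx : x * x = x)
    (hJ : x * jordanBlock R m 1 = jordanBlock R m 1 * x) : x = 0 ∨ x = 1 := by
  rcases Nat.eq_zero_or_pos m with rfl | hm
  · exact Or.inl (Subsingleton.elim _ _)
  let o : Fin m := ⟨0, hm⟩
  have ho : ∀ j : Fin m, j.val = 0 → j = o := fun j hj => Fin.ext hj
  have hN : (jordanBlock R m 1 - 1) * x = x * (jordanBlock R m 1 - 1) := by
    rw [sub_mul, mul_sub, hJ, one_mul, mul_one]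
  have hcol : ∀ i : Fin m, i ≠ o → x i o = 0 := by
    intro i hi
    have hi' : 0 < i.val := Nat.pos_of_ne_zero fun h => hi (ho i h)
    have h1 := jordanBlock_sub_one_mul_apply x ⟨i.val - 1, by omega⟩ (by simp; omega) o
    have h2 : (⟨i.val - 1 + 1, by omega⟩ : Fin m) = i := Fin.ext (by simp; omega)
    rw [hN, h2, Matrix.mul_apply, Finset.sum_eq_zero fun j _ => by
      rw [jordanBlock_sub_one_apply_zero _ _ rfl, mul_zero]] at h1
    exact h1.symm
  have hc : x o o * x o o = x o o := by
    conv_rhs => rw [← hx, Matrix.mul_apply]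
    rw [Finset.sum_eq_single o (fun j _ hj => by rw [hcol j hj, mul_zero]) (by simp)]
  rcases IsIdempotentElem.iff_eq_zero_or_one.1 hc with h | h
  · left
    refine eq_zero_of_idempotent_of_commute_jordanBlock hx hJ fun i j hj => ?_
    rw [ho j hj]
    by_cases hi : i = o
    · rw [hi, h]
    · exact hcol i hi
  · right
    have h1 : (1 - x) * (1 - x) = 1 - x := by noncomm_ring; rw [hx]; abel
    refine (sub_eq_zero.1 (eq_zero_of_idempotent_of_commute_jordanBlock h1 ?_ fun i j hj => ?_)).symm
    · rw [sub_mul, mul_sub, hJ, one_mul, mul_one]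
    · rw [ho j hj]
      by_cases hi : i = o
      · simp [hi, h]
      · simp [hcol i hi, Matrix.one_apply_ne hi]

/-! ### Fixed rows and columns of `1 ⊗ₖ C` for a companion matrix `C` -/

section FixedVectors

variable {S : Type*} [CommRing S] (m n : ℕ) (c : ℕ → S)

/-- The columns fixed by `1 ⊗ₖ C`. -/
def fixedColumns : Matrix (Fin m × Fin n) (Fin m × Fin 1) S :=
  (1 : Matrix (Fin m) (Fin m) S) ⊗ₖ (Matrix.of fun i _ => companionFixedVec n c i)

variable (S) in
/-- The rows fixed by `1 ⊗ₖ C`. -/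
def fixedRows : Matrix (Fin m × Fin 1) (Fin m × Fin n) S :=
  (1 : Matrix (Fin m) (Fin m) S) ⊗ₖ (Matrix.of fun _ _ => 1)

variable (S) in
/-- The columns `1 ⊗ₖ e₀`. -/
def firstColumns : Matrix (Fin m × Fin n) (Fin m × Fin 1) S :=
  (1 : Matrix (Fin m) (Fin m) S) ⊗ₖ (Matrix.of fun i _ => if i.val = 0 then 1 else 0)

variable {m n c}

theorem one_kronecker_matUbar : (1 : Matrix (Fin m) (Fin m) S) ⊗ₖ matUbar S n =
    firstColumns S m n * ((1 : Matrix (Fin m) (Fin m) S) ⊗ₖ rowU S n) := by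
  rw [firstColumns, ← Matrix.mul_kronecker_mul, one_mul]
  congr 1
  ext i j
  by_cases hi : i.val = 0 <;> simp [matUbar, rowU, Matrix.mul_apply, hi]

theorem kronecker_rowU (A : Matrix (Fin m) (Fin m) S) : A ⊗ₖ rowU S n =
    (A ⊗ₖ (1 : Matrix (Fin 1) (Fin 1) S)) * ((1 : Matrix (Fin m) (Fin m) S) ⊗ₖ rowU S n) := by
  rw [← Matrix.mul_kronecker_mul, mul_one, Matrix.one_mul]

theorem one_kronecker_mul_fixedColumns (hc : ∑ j ∈ Finset.range n, c j = -1) :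
    ((1 : Matrix (Fin m) (Fin m) S) ⊗ₖ companionOfCoeffs n c) * fixedColumns m n c =
      fixedColumns m n c := by
  rw [fixedColumns, ← Matrix.mul_kronecker_mul, one_mul]
  congr 1
  ext i j
  exact congrFun (companionOfCoeffs_mulVec_fixed hc) i

theorem one_kronecker_pow_mul_fixedColumns (hc : ∑ j ∈ Finset.range n, c j = -1) (r : ℕ) :
    ((1 : Matrix (Fin m) (Fin m) S) ⊗ₖ (companionOfCoeffs n c ^ r)) * fixedColumns m n c =
      fixedColumns m n c := by
  rw [← Matrix.one_kronecker_pow]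
  induction r with
  | zero => simp
  | succ r ih => rw [pow_succ, Matrix.mul_assoc, one_kronecker_mul_fixedColumns hc, ih]

theorem one_kronecker_rowU_mul_fixedColumns (hn : 0 < n)
    (hc : ∑ j ∈ Finset.range n, c j = -1) :
    ((1 : Matrix (Fin m) (Fin m) S) ⊗ₖ rowU S n) * fixedColumns m n c = 1 := by
  rw [fixedColumns, ← Matrix.mul_kronecker_mul, one_mul, ← Matrix.one_kronecker_one]
  congr 1
  ext i j
  rw [Matrix.mul_apply, Finset.sum_eq_single (⟨n - 1, by omega⟩ : Fin n)]
  · have h : n - 1 + 1 = n := by omega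
    rw [Matrix.of_apply, companionFixedVec_last hc h, Subsingleton.elim i j]
    simp [rowU, h]
  · intro l _ hl
    have h : ¬ l.val + 1 = n := fun h => hl (Fin.ext (by simp; omega))
    simp [rowU, h]
  · simp

/-- The difference of the two sides is fixed by $1\otimes C$ and has zero last entry in every block,
so it vanishes. -/
theorem fixedColumns_mul_eq {β : Type*} (hc : ∑ j ∈ Finset.range n, c j = -1)
    {Z : Matrix (Fin m × Fin n) β S}
    (hZ : ((1 : Matrix (Fin m) (Fin m) S) ⊗ₖ companionOfCoeffs n c) * Z = Z) :
    fixedColumns m n c * (((1 : Matrix (Fin m) (Fin m) S) ⊗ₖ rowU S n) * Z) = Z := by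
  refine (sub_eq_zero.1 ?_).symm
  set D := Z - fixedColumns m n c * (((1 : Matrix (Fin m) (Fin m) S) ⊗ₖ rowU S n) * Z) with hD
  have hfix : ((1 : Matrix (Fin m) (Fin m) S) ⊗ₖ companionOfCoeffs n c) * D = D := by
    rw [hD, Matrix.mul_sub, hZ, ← Matrix.mul_assoc, one_kronecker_mul_fixedColumns hc]
  rcases Nat.eq_zero_or_pos n with hn | hn
  · subst hn
    ext ⟨_, i⟩
    exact i.elim0
  have hrow : ((1 : Matrix (Fin m) (Fin m) S) ⊗ₖ rowU S n) * D = 0 := by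
    rw [hD, Matrix.mul_sub, ← Matrix.mul_assoc, one_kronecker_rowU_mul_fixedColumns hn hc,
      Matrix.one_mul, sub_self]
  ext ⟨k, i⟩ b
  refine congrFun (eq_zero_of_companionOfCoeffs_mulVec (n := n) (c := c)
    (z := fun j => D (k, j) b) ?_ ?_) i
  · ext i
    rw [← Matrix.one_kronecker_mul_apply, hfix]
  · intro j hj
    have h := congrFun (congrFun hrow (k, 0)) b
    rw [Matrix.one_kronecker_mul_apply, Matrix.mulVec, dotProduct, Finset.sum_eq_single j] at h
    · simpa [rowU, hj] using h
    · intro l _ hl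
      have h : ¬ l.val + 1 = n := fun h => hl (Fin.ext (by omega))
      simp [rowU, h]
    · simp

theorem fixedRows_mul_one_kronecker (hc : ∑ j ∈ Finset.range n, c j = -1) :
    fixedRows S m n * ((1 : Matrix (Fin m) (Fin m) S) ⊗ₖ companionOfCoeffs n c) =
      fixedRows S m n := by
  rw [fixedRows, ← Matrix.mul_kronecker_mul, one_mul]
  congr 1
  ext i j
  exact congrFun (companionOfCoeffs_one_vecMul hc) j

theorem fixedRows_mul_firstColumns (hn : 0 < n) : fixedRows S m n * firstColumns S m n = 1 := by
  rw [fixedRows, firstColumns, ← Matrix.mul_kronecker_mul, one_mul, ← Matrix.one_kronecker_one]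
  congr 1
  ext i j
  rw [Matrix.mul_apply, Finset.sum_eq_single (⟨0, hn⟩ : Fin n), Subsingleton.elim i j]
  · simp
  · intro l _ hl
    have h : ¬ l.val = 0 := fun h => hl (Fin.ext h)
    simp [h]
  · simp

theorem mul_fixedRows_eq {β : Type*} (hn : 0 < n)
    {W : Matrix β (Fin m × Fin n) S}
    (hW : W * ((1 : Matrix (Fin m) (Fin m) S) ⊗ₖ companionOfCoeffs n c) = W) :
    (W * firstColumns S m n) * fixedRows S m n = W := by
  ext b ⟨k, i⟩
  rw [fixedRows, Matrix.mul_one_kronecker_apply, firstColumns]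
  simp only [Matrix.vecMul, dotProduct, Matrix.of_apply, mul_one, Finset.univ_unique,
    Finset.sum_singleton]
  rw [Matrix.mul_one_kronecker_apply, Matrix.vecMul, dotProduct,
    Finset.sum_eq_single (⟨0, hn⟩ : Fin n)]
  · have := eq_of_companionOfCoeffs_vecMul (n := n) (c := c) (w := fun j => W b (k, j))
      (by ext i; rw [← Matrix.mul_one_kronecker_apply, hW]) (i₀ := ⟨0, hn⟩) rfl i
    simpa using this.symm
  · intro l _ hl
    have h : ¬ l.val = 0 := fun h => hl (Fin.ext h)
    simp [h]
  · simp

end FixedVectors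

theorem eq_zero_or_one_of_idempotent_of_commute_kronecker {κ : Type*} [Field κ] {m : ℕ}
    {x : Matrix (Fin m × Fin 1) (Fin m × Fin 1) κ} (hx : x * x = x)
    (hJ : x * (jordanBlock κ m 1 ⊗ₖ (1 : Matrix (Fin 1) (Fin 1) κ)) =
      (jordanBlock κ m 1 ⊗ₖ (1 : Matrix (Fin 1) (Fin 1) κ)) * x) : x = 0 ∨ x = 1 := by
  let e := Matrix.reindexAlgEquiv κ κ (Equiv.prodUnique (Fin m) (Fin 1))
  have hJe : e (jordanBlock κ m 1 ⊗ₖ (1 : Matrix (Fin 1) (Fin 1) κ)) = jordanBlock κ m 1 := by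
    ext i j
    simp [e]
  have h := eq_zero_or_one_of_idempotent_of_commute_jordanBlock (x := e x)
    (by rw [← map_mul, hx]) (by rw [← hJe, ← map_mul, hJ, map_mul])
  rcases h with h | h
  · exact Or.inl ((map_eq_zero_iff e e.injective).1 h)
  · exact Or.inr ((map_eq_one_iff e e.injective).1 h)

/-! ### The block equations over the residue field -/

section Reduction

variable {κ : Type*} [Field κ] {m n : ℕ} {c : ℕ → κ} {r₂ r₃ : ℕ}
  {P₀ : Matrix (Fin m × Fin 1) (Fin m × Fin 1) κ}
  {P₁ K₂ K₃ : Matrix (Fin m × Fin n) (Fin m × Fin n) κ}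
  {Q₀₂ Q₀₃ : Matrix (Fin m × Fin 1) (Fin m × Fin n) κ}
  {Q₁₂ Q₁₃ : Matrix (Fin m × Fin n) (Fin m × Fin n) κ}

local notation "Cₘ" => (1 : Matrix (Fin m) (Fin m) κ) ⊗ₖ companionOfCoeffs n c
local notation "Uₘ" => (1 : Matrix (Fin m) (Fin m) κ) ⊗ₖ rowU κ n
local notation "Vₘ" => fixedColumns m n c
local notation "Lₘ" => fixedRows κ m n

theorem mul_fixedColumns_of_commute (hc : ∑ j ∈ Finset.range n, c j = -1)
    {K : Matrix (Fin m × Fin n) (Fin m × Fin n) κ} (hK : K * Cₘ = Cₘ * K) :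
    Vₘ * (Uₘ * (K * Vₘ)) = K * Vₘ := by
  refine fixedColumns_mul_eq hc ?_
  rw [← Matrix.mul_assoc, ← hK, Matrix.mul_assoc, one_kronecker_mul_fixedColumns hc]

/-- Right multiplication by $V$ turns $Q(1\otimes C^r)$ into $QV$, which cancels the unknown $Q$;
moreover $UV=1$. -/
theorem first_block_eq (hn : 0 < n) (hc : ∑ j ∈ Finset.range n, c j = -1) {r : ℕ}
    {A : Matrix (Fin m) (Fin m) κ} {Q : Matrix (Fin m × Fin 1) (Fin m × Fin n) κ}
    {K : Matrix (Fin m × Fin n) (Fin m × Fin n) κ}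
    (h : P₀ * (A ⊗ₖ rowU κ n) + Q * ((1 : Matrix (Fin m) (Fin m) κ) ⊗ₖ (companionOfCoeffs n c ^ r)) =
      Q + (A ⊗ₖ rowU κ n) * K) :
    P₀ * (A ⊗ₖ (1 : Matrix (Fin 1) (Fin 1) κ)) =
      (A ⊗ₖ (1 : Matrix (Fin 1) (Fin 1) κ)) * (Uₘ * (K * Vₘ)) := by
  have h1 := congrArg (· * Vₘ) h
  simp only [Matrix.add_mul, Matrix.mul_assoc, one_kronecker_pow_mul_fixedColumns hc] at h1
  rw [add_comm, add_left_cancel_iff, kronecker_rowU, Matrix.mul_assoc, Matrix.mul_assoc,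
    one_kronecker_rowU_mul_fixedColumns hn hc, Matrix.mul_one] at h1
  exact h1

/-- Here $Q$ is acted on from both sides, so $V$ on the right and $L$ on the left are needed to
cancel it. The factorization $\overline u=e_0u$, with $Le=1$ and $UV=1$, isolates the two remaining
terms. -/
theorem second_block_eq (hn : 0 < n) (hc : ∑ j ∈ Finset.range n, c j = -1) {r : ℕ}
    {Q K : Matrix (Fin m × Fin n) (Fin m × Fin n) κ}
    (h : P₁ * ((1 : Matrix (Fin m) (Fin m) κ) ⊗ₖ matUbar κ n) +
        Q * ((1 : Matrix (Fin m) (Fin m) κ) ⊗ₖ (companionOfCoeffs n c ^ r)) =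
      Cₘ * Q + ((1 : Matrix (Fin m) (Fin m) κ) ⊗ₖ matUbar κ n) * K) :
    Lₘ * P₁ * firstColumns κ m n = Uₘ * (K * Vₘ) := by
  have h1 := congrArg (fun Z => Lₘ * (Z * Vₘ)) h
  simp only [Matrix.add_mul, Matrix.mul_add, Matrix.mul_assoc,
    one_kronecker_pow_mul_fixedColumns hc, one_kronecker_matUbar,
    one_kronecker_rowU_mul_fixedColumns hn hc, Matrix.mul_one] at h1
  rw [← Matrix.mul_assoc Lₘ Cₘ, fixedRows_mul_one_kronecker hc, add_comm,
    add_left_cancel_iff, ← Matrix.mul_assoc Lₘ (firstColumns κ m n),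
    fixedRows_mul_firstColumns hn, Matrix.one_mul, ← Matrix.mul_assoc] at h1
  exact h1

theorem eq_zero_of_mul_fixedColumns (hc : ∑ j ∈ Finset.range n, c j = -1)
    (hnil : IsNilpotent (companionOfCoeffs n c - 1))
    {K : Matrix (Fin m × Fin n) (Fin m × Fin n) κ} (hK : K * K = K) (hKC : K * Cₘ = Cₘ * K)
    (hKV : Uₘ * (K * Vₘ) = 0) : K = 0 := by
  have hV : K * Vₘ = 0 := by rw [← mul_fixedColumns_of_commute hc hKC, hKV, Matrix.mul_zero]
  refine IsIdempotentElem.eq_zero_of_left_annihilator (b := Cₘ - 1) hK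
    (Commute.sub_right hKC (Commute.one_right K)) ?_ ?_
  · have := hnil.map (Matrix.oneKroneckerAlgHom κ (Fin m) (Fin n))
    rwa [map_sub, map_one] at this
  · intro z hz
    have hz' : Cₘ * z = z := by rwa [sub_mul, one_mul, sub_eq_zero] at hz
    rw [← fixedColumns_mul_eq hc hz', ← Matrix.mul_assoc, hV, Matrix.zero_mul]

theorem eq_zero_of_fixedRows_mul (hn : 0 < n) (hc : ∑ j ∈ Finset.range n, c j = -1)
    (hnil : IsNilpotent (companionOfCoeffs n c - 1))
    (hK : P₁ * P₁ = P₁) (hKC : P₁ * Cₘ = Cₘ * P₁)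
    (hKV : Lₘ * P₁ * firstColumns κ m n = 0) : P₁ = 0 := by
  have hL : Lₘ * P₁ = 0 := by
    rw [← mul_fixedRows_eq (c := c) hn (W := Lₘ * P₁), hKV, Matrix.zero_mul]
    rw [Matrix.mul_assoc, hKC, ← Matrix.mul_assoc, fixedRows_mul_one_kronecker hc]
  refine IsIdempotentElem.eq_zero_of_right_annihilator (b := Cₘ - 1) hK
    (Commute.sub_right hKC (Commute.one_right P₁)) ?_ ?_
  · have := hnil.map (Matrix.oneKroneckerAlgHom κ (Fin m) (Fin n))
    rwa [map_sub, map_one] at this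
  · intro z hz
    have hz' : z * Cₘ = z := by rwa [mul_sub, mul_one, sub_eq_zero] at hz
    rw [← mul_fixedRows_eq hn hz', Matrix.mul_assoc, hL, Matrix.mul_zero]

/-- The four diagonal blocks of an idempotent matrix commuting with `Γ_m(a)` over the residue
field. -/
theorem diagonal_blocks_of_idempotent (hn : 0 < n) (hc : ∑ j ∈ Finset.range n, c j = -1)
    (hnil : IsNilpotent (companionOfCoeffs n c - 1))
    (hP₀ : P₀ * P₀ = P₀) (hP₁ : P₁ * P₁ = P₁) (hK₂ : K₂ * K₂ = K₂) (hK₃ : K₃ * K₃ = K₃)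
    (hP₁C : P₁ * Cₘ = Cₘ * P₁) (hK₂C : K₂ * Cₘ = Cₘ * K₂) (hK₃C : K₃ * Cₘ = Cₘ * K₃)
    (h₀₂ : P₀ * Uₘ + Q₀₂ * ((1 : Matrix (Fin m) (Fin m) κ) ⊗ₖ (companionOfCoeffs n c ^ r₂)) =
      Q₀₂ + Uₘ * K₂)
    (h₀₃ : P₀ * (jordanBlock κ m 1 ⊗ₖ rowU κ n) +
        Q₀₃ * ((1 : Matrix (Fin m) (Fin m) κ) ⊗ₖ (companionOfCoeffs n c ^ r₃)) =
      Q₀₃ + (jordanBlock κ m 1 ⊗ₖ rowU κ n) * K₃)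
    (h₁₂ : P₁ * ((1 : Matrix (Fin m) (Fin m) κ) ⊗ₖ matUbar κ n) +
        Q₁₂ * ((1 : Matrix (Fin m) (Fin m) κ) ⊗ₖ (companionOfCoeffs n c ^ r₂)) =
      Cₘ * Q₁₂ + ((1 : Matrix (Fin m) (Fin m) κ) ⊗ₖ matUbar κ n) * K₂)
    (h₁₃ : P₁ * ((1 : Matrix (Fin m) (Fin m) κ) ⊗ₖ matUbar κ n) +
        Q₁₃ * ((1 : Matrix (Fin m) (Fin m) κ) ⊗ₖ (companionOfCoeffs n c ^ r₃)) =
      Cₘ * Q₁₃ + ((1 : Matrix (Fin m) (Fin m) κ) ⊗ₖ matUbar κ n) * K₃) :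
    (P₀ = 0 ∨ P₀ = 1) ∧ (P₀ = 0 → P₁ = 0 ∧ K₂ = 0 ∧ K₃ = 0) := by
  have e₂ := first_block_eq hn hc h₀₂
  have e₃ := first_block_eq hn hc h₀₃
  rw [Matrix.one_kronecker_one, Matrix.mul_one, Matrix.one_mul] at e₂
  have f₂ := second_block_eq hn hc h₁₂
  have f₃ := second_block_eq hn hc h₁₃
  -- The second block row gives $UK_3V=UK_2V=P_0$, which turns the $J$-equation into $P_0J=JP_0$.
  rw [← f₃, f₂, ← e₂] at e₃
  refine ⟨eq_zero_or_one_of_idempotent_of_commute_kronecker hP₀ e₃, fun h => ⟨?_, ?_, ?_⟩⟩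
  · exact eq_zero_of_fixedRows_mul hn hc hnil hP₁ hP₁C (by rw [f₂, ← e₂, h])
  · exact eq_zero_of_mul_fixedColumns hc hnil hK₂ hK₂C (by rw [← e₂, h])
  · exact eq_zero_of_mul_fixedColumns hc hnil hK₃ hK₃C (by rw [← f₃, f₂, ← e₂, h])

end Reduction

/-! ### Matrices commuting with `Γ_m(a)` -/

theorem Matrix.map_kronecker_ringHom {R S l m n o : Type*} [CommRing R] [CommRing S] (φ : R →+* S)
    (A : Matrix l m R) (B : Matrix n o R) : (A ⊗ₖ B).map φ = A.map φ ⊗ₖ B.map φ := by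
  ext ⟨i, j⟩ ⟨k, l⟩
  simp

theorem rowU_map {R S : Type*} [CommRing R] [CommRing S] (φ : R →+* S) (n : ℕ) :
    (rowU R n).map φ = rowU S n := by
  ext i j
  simp [rowU, apply_ite φ]

theorem matUbar_map {R S : Type*} [CommRing R] [CommRing S] (φ : R →+* S) (n : ℕ) :
    (matUbar R n).map φ = matUbar S n := by
  ext i j
  simp [matUbar, apply_ite φ]

theorem jordanBlock_map {R S : Type*} [CommRing R] [CommRing S] (φ : R →+* S) (m : ℕ) :
    (jordanBlock R m 1).map φ = jordanBlock S m 1 := by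
  ext i j
  simp [jordanBlock, apply_ite φ]

theorem Matrix.map_one_ringHom {R S l : Type*} [CommRing R] [CommRing S] [DecidableEq l]
    (φ : R →+* S) : (1 : Matrix l l R).map φ = 1 :=
  Matrix.map_one φ (map_zero φ) (map_one φ)

theorem Matrix.map_pow_ringHom {R S l : Type*} [CommRing R] [CommRing S] [Fintype l]
    [DecidableEq l] (φ : R →+* S) (A : Matrix l l R) (r : ℕ) : (A ^ r).map φ = (A.map φ) ^ r :=
  map_pow φ.mapMatrix A r

/-- After reduction $f$ kills the upper diagonal block and $g$ the lower one, and
$\begin{pmatrix}0&*\\0&*\end{pmatrix}\begin{pmatrix}*&*\\0&0\end{pmatrix}=0$. -/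
theorem map_aeval_fromBlocks_eq_zero {R κ α β : Type*} [CommRing R] [CommRing κ] [Fintype α] [DecidableEq α]
    [Fintype β] [DecidableEq β] (φ : R →+* κ) {A : Matrix α α R} (B : Matrix α β R)
    {D : Matrix β β R} {f g : R[X]} (hf : (aeval A f).map φ = 0) (hg : aeval D g = 0) :
    (aeval (Matrix.fromBlocks A B 0 D) (f * g)).map φ = 0 := by
  obtain ⟨B₁, h₁⟩ := Matrix.exists_aeval_fromBlocks A B D f
  obtain ⟨B₂, h₂⟩ := Matrix.exists_aeval_fromBlocks A B D g
  rw [map_mul, h₁, h₂, hg, Matrix.map_mul, Matrix.fromBlocks_map, Matrix.fromBlocks_map, hf,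
    Matrix.fromBlocks_multiply]
  simp [Matrix.map_zero φ (map_zero φ)]

/-- The hypotheses on `η₁, η₂, η₃, r₂, r₃` under which `Γ_m` is an indecomposable representation
of the cyclic group of order `p`. -/
structure GammaData {R : Type*} [CommRing R] (p : ℕ) (η₁ η₂ η₃ : R[X]) (r₂ r₃ : ℕ) : Prop where
  monic : η₁.Monic
  natDegree_pos : 0 < η₁.natDegree
  dvd : (X - 1) * η₁ * (η₂ * η₃) ∣ X ^ p - 1
  root₂ : aeval (companionMatrix η₁ ^ r₂) η₂ = 0
  root₃ : aeval (companionMatrix η₁ ^ r₃) η₃ = 0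
  coprime₂ : r₂.Coprime p
  coprime₃ : r₃.Coprime p

theorem aeval_gammaMatrix_lower {R : Type*} [CommRing R] {p : ℕ} {η₁ η₂ η₃ : R[X]} {r₂ r₃ m : ℕ}
    (h : GammaData p η₁ η₂ η₃ r₂ r₃) :
    aeval (Matrix.fromBlocks ((1 : Matrix (Fin m) (Fin m) R) ⊗ₖ (companionMatrix η₁ ^ r₂)) 0 0
      ((1 : Matrix (Fin m) (Fin m) R) ⊗ₖ (companionMatrix η₁ ^ r₃))) (η₂ * η₃) = 0 := by
  simp only [Matrix.aeval_fromBlocks_diagonal, map_mul, Matrix.aeval_one_kronecker, h.root₂,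
    h.root₃, Matrix.kronecker_zero, Matrix.fromBlocks_multiply, mul_zero, zero_mul, add_zero,
    Matrix.fromBlocks_zero]

section Commutant

variable {R : Type*} [CommRing R] [IsDomain R] {p : ℕ} {η₁ η₂ η₃ : R[X]} {r₂ r₃ m : ℕ}

local notation "Eₘ" => (1 : Matrix (Fin m) (Fin m) R)

theorem companionMatrix_pow_eq_one (h : GammaData p η₁ η₂ η₃ r₂ r₃) :
    companionMatrix η₁ ^ p = 1 := by
  have hd : η₁ ∣ X ^ p - 1 := (((dvd_mul_left η₁ (X - 1)).mul_right _)).trans h.dvd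
  obtain ⟨q, hq⟩ := hd
  have h1 := congrArg (aeval (companionMatrix η₁)) hq
  rw [map_mul, aeval_companionMatrix h.monic, zero_mul] at h1
  simpa [sub_eq_zero] using h1

/-- When $rs\equiv1\pmod p$, $y=(y^r)^s$ is itself a power of $y^r$. -/
theorem commute_of_commute_pow {S : Type*} [Monoid S] {p r : ℕ} {x y : S} (hp : 1 < p)
    (hr : r.Coprime p) (hy : y ^ p = 1) (h : x * y ^ r = y ^ r * x) : x * y = y * x := by
  obtain ⟨s, hs⟩ := Nat.exists_mul_mod_eq_one_of_coprime hr hp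
  have h1 : (y ^ r) ^ s = y := by
    rw [← pow_mul, ← Nat.div_add_mod (r * s) p, hs.2, pow_add, pow_mul, hy, one_pow, one_mul, pow_one]
  have h2 : Commute x ((y ^ r) ^ s) := Commute.pow_right h s
  rw [h1] at h2
  exact h2

theorem aeval_one_kronecker_companionMatrix (h : GammaData p η₁ η₂ η₃ r₂ r₃) :
    aeval (Eₘ ⊗ₖ companionMatrix η₁) η₁ = 0 := by
  rw [Matrix.aeval_one_kronecker, aeval_companionMatrix h.monic, Matrix.kronecker_zero]

theorem exists_blocks_of_commute (hp : 1 < p) (hpR : (p : R) ≠ 0)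
    (h : GammaData p η₁ η₂ η₃ r₂ r₃)
    {Z : Matrix (GammaIndex m η₁.natDegree) (GammaIndex m η₁.natDegree) R}
    (hZ : Z * gammaMatrix η₁ r₂ r₃ m = gammaMatrix η₁ r₂ r₃ m * Z) :
    ∃ P₀ P₁ Q₀₂ Q₀₃ Q₁₂ Q₁₃ K₂ K₃,
      Z = Matrix.fromBlocks (Matrix.fromBlocks P₀ 0 0 P₁) (Matrix.fromBlocks Q₀₂ Q₀₃ Q₁₂ Q₁₃) 0
        (Matrix.fromBlocks K₂ 0 0 K₃) ∧
      P₁ * (Eₘ ⊗ₖ companionMatrix η₁) = (Eₘ ⊗ₖ companionMatrix η₁) * P₁ ∧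
      K₂ * (Eₘ ⊗ₖ companionMatrix η₁) = (Eₘ ⊗ₖ companionMatrix η₁) * K₂ ∧
      K₃ * (Eₘ ⊗ₖ companionMatrix η₁) = (Eₘ ⊗ₖ companionMatrix η₁) * K₃ ∧
      P₀ * (Eₘ ⊗ₖ rowU R η₁.natDegree) + Q₀₂ * (Eₘ ⊗ₖ (companionMatrix η₁ ^ r₂)) =
        Q₀₂ + (Eₘ ⊗ₖ rowU R η₁.natDegree) * K₂ ∧
      P₀ * (jordanBlock R m 1 ⊗ₖ rowU R η₁.natDegree) + Q₀₃ * (Eₘ ⊗ₖ (companionMatrix η₁ ^ r₃)) =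
        Q₀₃ + (jordanBlock R m 1 ⊗ₖ rowU R η₁.natDegree) * K₃ ∧
      P₁ * (Eₘ ⊗ₖ matUbar R η₁.natDegree) + Q₁₂ * (Eₘ ⊗ₖ (companionMatrix η₁ ^ r₂)) =
        (Eₘ ⊗ₖ companionMatrix η₁) * Q₁₂ + (Eₘ ⊗ₖ matUbar R η₁.natDegree) * K₂ ∧
      P₁ * (Eₘ ⊗ₖ matUbar R η₁.natDegree) + Q₁₃ * (Eₘ ⊗ₖ (companionMatrix η₁ ^ r₃)) =
        (Eₘ ⊗ₖ companionMatrix η₁) * Q₁₃ + (Eₘ ⊗ₖ matUbar R η₁.natDegree) * K₃ := by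
  obtain ⟨Z₁₁, Z₁₂, Z₂₁, Z₂₂, rfl⟩ : ∃ Z₁₁ Z₁₂ Z₂₁ Z₂₂, Z = Matrix.fromBlocks Z₁₁ Z₁₂ Z₂₁ Z₂₂ :=
    ⟨_, _, _, _, (Matrix.fromBlocks_toBlocks Z).symm⟩
  simp only [gammaMatrix, Matrix.one_kronecker_one] at hZ
  rw [Matrix.fromBlocks_multiply, Matrix.fromBlocks_multiply, Matrix.fromBlocks_inj] at hZ
  obtain ⟨z₁₁, z₁₂, z₂₁, z₂₂⟩ := hZ
  obtain ⟨P₀, P₀₁, P₁₀, P₁, rfl⟩ : ∃ A B C D, Z₁₁ = Matrix.fromBlocks A B C D :=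
    ⟨_, _, _, _, (Matrix.fromBlocks_toBlocks Z₁₁).symm⟩
  obtain ⟨Q₀₂, Q₀₃, Q₁₂, Q₁₃, rfl⟩ : ∃ A B C D, Z₁₂ = Matrix.fromBlocks A B C D :=
    ⟨_, _, _, _, (Matrix.fromBlocks_toBlocks Z₁₂).symm⟩
  obtain ⟨K₂, K₂₃, K₃₂, K₃, rfl⟩ : ∃ A B C D, Z₂₂ = Matrix.fromBlocks A B C D :=
    ⟨_, _, _, _, (Matrix.fromBlocks_toBlocks Z₂₂).symm⟩
  have hX : aeval (1 : Matrix (Fin m × Fin 1) (Fin m × Fin 1) R) (X - 1 : R[X]) = 0 := by simp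
  have hC := aeval_one_kronecker_companionMatrix (m := m) h
  have hC₂ : aeval (Eₘ ⊗ₖ (companionMatrix η₁ ^ r₂)) η₂ = 0 := by
    rw [Matrix.aeval_one_kronecker, h.root₂, Matrix.kronecker_zero]
  have hC₃ : aeval (Eₘ ⊗ₖ (companionMatrix η₁ ^ r₃)) η₃ = 0 := by
    rw [Matrix.aeval_one_kronecker, h.root₃, Matrix.kronecker_zero]
  have hd₁ : (X - 1) * η₁ ∣ X ^ p - 1 := (Dvd.intro _ rfl).trans h.dvd
  have hd₂ : η₂ * η₃ ∣ X ^ p - 1 := (Dvd.intro_left _ rfl).trans h.dvd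
  simp only [Matrix.mul_zero, Matrix.zero_mul, add_zero, zero_add] at z₁₁ z₁₂ z₂₁ z₂₂
  -- The lower left block intertwines the two diagonal halves of $\Gamma$, annihilated by
  -- $(X-1)\eta_1$ and $\eta_2\eta_3$. It must vanish before the finer blocks can be compared.
  have hZ₂₁ : Z₂₁ = 0 := by
    refine Matrix.eq_zero_of_intertwines hpR h.dvd z₂₁ ?_ ?_
    · rw [Matrix.aeval_fromBlocks_diagonal, map_mul, map_mul, hX, hC, zero_mul, mul_zero,
        Matrix.fromBlocks_zero]
    · rw [Matrix.aeval_fromBlocks_diagonal, map_mul, map_mul, hC₂, hC₃, zero_mul, mul_zero,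
        Matrix.fromBlocks_zero]
  subst hZ₂₁
  simp only [Matrix.mul_zero, Matrix.zero_mul, add_zero, zero_add] at z₁₁ z₂₂
  rw [Matrix.fromBlocks_multiply, Matrix.fromBlocks_multiply, Matrix.fromBlocks_inj] at z₁₁ z₂₂
  simp only [Matrix.fromBlocks_multiply, Matrix.fromBlocks_add, Matrix.fromBlocks_inj] at z₁₂
  simp only [Matrix.mul_zero, Matrix.zero_mul, add_zero, zero_add] at z₁₁ z₁₂ z₂₂
  obtain ⟨-, a₀₁, a₁₀, a₁₁⟩ := z₁₁
  obtain ⟨a₂₂, a₂₃, a₃₂, a₃₃⟩ := z₂₂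
  have hP₀₁ : P₀₁ = 0 := Matrix.eq_zero_of_intertwines hpR (mul_comm (X - 1) η₁ ▸ hd₁) a₀₁ hC hX
  have hP₁₀ : P₁₀ = 0 := Matrix.eq_zero_of_intertwines hpR hd₁ a₁₀ hX hC
  have hK₂₃ : K₂₃ = 0 := Matrix.eq_zero_of_intertwines hpR (mul_comm η₂ η₃ ▸ hd₂) a₂₃ hC₃ hC₂
  have hK₃₂ : K₃₂ = 0 := Matrix.eq_zero_of_intertwines hpR hd₂ a₃₂ hC₂ hC₃
  subst hP₀₁ hP₁₀ hK₂₃ hK₃₂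
  simp only [Matrix.mul_zero, Matrix.zero_mul, add_zero, zero_add, Matrix.one_mul] at z₁₂
  obtain ⟨b₀₂, b₀₃, b₁₂, b₁₃⟩ := z₁₂
  have hone : (Eₘ ⊗ₖ companionMatrix η₁) ^ p = 1 := by
    rw [Matrix.one_kronecker_pow, companionMatrix_pow_eq_one h, Matrix.one_kronecker_one]
  rw [← Matrix.one_kronecker_pow] at a₂₂ a₃₃
  exact ⟨P₀, P₁, Q₀₂, Q₀₃, Q₁₂, Q₁₃, K₂, K₃, rfl, a₁₁,
    commute_of_commute_pow hp h.coprime₂ hone a₂₂, commute_of_commute_pow hp h.coprime₃ hone a₃₃,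
    b₀₂, b₀₃, b₁₂, b₁₃⟩

theorem idempotent_blocks_of_commute (hp : 1 < p) (hpR : (p : R) ≠ 0)
    (h : GammaData p η₁ η₂ η₃ r₂ r₃) {κ : Type*} [Field κ] (φ : R →+* κ)
    (hev : φ (η₁.eval 1) = 0) (hnil : IsNilpotent ((companionMatrix η₁).map φ - 1))
    {Z : Matrix (GammaIndex m η₁.natDegree) (GammaIndex m η₁.natDegree) R}
    (hidem : Z * Z = Z) (hZ : Z * gammaMatrix η₁ r₂ r₃ m = gammaMatrix η₁ r₂ r₃ m * Z) :
    (Z.toBlocks₁₁.toBlocks₁₁.map φ = 0 ∨ Z.toBlocks₁₁.toBlocks₁₁.map φ = 1) ∧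
      (Z.toBlocks₁₁.toBlocks₁₁.map φ = 0 → Z = 0) := by
  obtain ⟨P₀, P₁, Q₀₂, Q₀₃, Q₁₂, Q₁₃, K₂, K₃, rfl, c₁, c₂, c₃, b₀₂, b₀₃, b₁₂, b₁₃⟩ :=
    exists_blocks_of_commute hp hpR h hZ
  have hid := hidem
  rw [Matrix.fromBlocks_multiply, Matrix.fromBlocks_inj] at hid
  simp only [Matrix.fromBlocks_multiply, Matrix.mul_zero, Matrix.zero_mul, add_zero, zero_add,
    Matrix.fromBlocks_inj, true_and] at hid
  obtain ⟨⟨i₀, i₁⟩, -, ⟨i₂, i₃⟩⟩ := hid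
  -- This is $\eta_1(1)=0$ in $\kappa$, with the leading coefficient $1$ moved to the other side.
  have hc : ∑ j ∈ Finset.range η₁.natDegree, φ (η₁.coeff j) = -1 := by
    rw [eval_eq_sum_range, Finset.sum_range_succ, h.monic.coeff_natDegree] at hev
    simp only [one_pow, mul_one, map_add, map_sum, map_one] at hev
    exact eq_neg_of_add_eq_zero_left hev
  rw [companionMatrix_map] at hnil
  have key := diagonal_blocks_of_idempotent (m := m) (r₂ := r₂) (r₃ := r₃)
    (P₀ := P₀.map φ) (P₁ := P₁.map φ) (K₂ := K₂.map φ) (K₃ := K₃.map φ) (Q₀₂ := Q₀₂.map φ)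
    (Q₀₃ := Q₀₃.map φ) (Q₁₂ := Q₁₂.map φ) (Q₁₃ := Q₁₃.map φ) h.natDegree_pos hc hnil
    (by rw [← Matrix.map_mul, i₀]) (by rw [← Matrix.map_mul, i₁]) (by rw [← Matrix.map_mul, i₂])
    (by rw [← Matrix.map_mul, i₃])
  have hmapadd : ∀ {α β : Type} (A B : Matrix α β R), (A + B).map φ = A.map φ + B.map φ :=
    fun A B => Matrix.map_add φ (map_add φ) A B
  replace c₁ := congrArg (fun A => A.map φ) c₁
  replace c₂ := congrArg (fun A => A.map φ) c₂
  replace c₃ := congrArg (fun A => A.map φ) c₃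
  replace b₀₂ := congrArg (fun A => A.map φ) b₀₂
  replace b₀₃ := congrArg (fun A => A.map φ) b₀₃
  replace b₁₂ := congrArg (fun A => A.map φ) b₁₂
  replace b₁₃ := congrArg (fun A => A.map φ) b₁₃
  simp only [Matrix.map_mul, hmapadd, Matrix.map_kronecker_ringHom, rowU_map, matUbar_map,
    jordanBlock_map, Matrix.map_one_ringHom, Matrix.map_pow_ringHom, companionMatrix_map]
    at c₁ c₂ c₃ b₀₂ b₀₃ b₁₂ b₁₃
  obtain ⟨k₁, k₂⟩ := key c₁ c₂ c₃ b₀₂ b₀₃ b₁₂ b₁₃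
  simp only [Matrix.toBlocks_fromBlocks₁₁]
  refine ⟨k₁, fun h0 => ?_⟩
  obtain ⟨z₁, z₂, z₃⟩ := k₂ h0
  have e₀ := Matrix.eq_zero_of_idempotent_of_map_eq_zero φ i₀ h0
  have e₁ := Matrix.eq_zero_of_idempotent_of_map_eq_zero φ i₁ z₁
  have e₂ := Matrix.eq_zero_of_idempotent_of_map_eq_zero φ i₂ z₂
  have e₃ := Matrix.eq_zero_of_idempotent_of_map_eq_zero φ i₃ z₃
  subst e₀ e₁ e₂ e₃
  -- With zero diagonal blocks only the upper right corner of $Z$ remains, so $Z=Z^2=0$.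
  rw [← hidem, Matrix.fromBlocks_multiply]
  simp

theorem eq_zero_or_one_of_idempotent_of_commute (hp : 1 < p) (hpR : (p : R) ≠ 0)
    (h : GammaData p η₁ η₂ η₃ r₂ r₃) {κ : Type*} [Field κ] (φ : R →+* κ)
    (hev : φ (η₁.eval 1) = 0) (hnil : IsNilpotent ((companionMatrix η₁).map φ - 1))
    {Z : Matrix (GammaIndex m η₁.natDegree) (GammaIndex m η₁.natDegree) R}
    (hidem : Z * Z = Z) (hZ : Z * gammaMatrix η₁ r₂ r₃ m = gammaMatrix η₁ r₂ r₃ m * Z) :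
    Z = 0 ∨ Z = 1 := by
  obtain ⟨h1, h2⟩ := idempotent_blocks_of_commute hp hpR h φ hev hnil hidem hZ
  refine h1.imp h2 fun h1 => ?_
  have hidem' : (1 - Z) * (1 - Z) = 1 - Z := by
    rw [sub_mul, mul_sub, mul_sub, hidem]
    simp
  have hZ' : (1 - Z) * gammaMatrix η₁ r₂ r₃ m = gammaMatrix η₁ r₂ r₃ m * (1 - Z) := by
    rw [sub_mul, mul_sub, hZ, one_mul, mul_one]
  refine (sub_eq_zero.1 ((idempotent_blocks_of_commute hp hpR h φ hev hnil hidem' hZ').2 ?_)).symm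
  have : (1 - Z).toBlocks₁₁.toBlocks₁₁ = 1 - Z.toBlocks₁₁.toBlocks₁₁ := by
    ext i j
    simp [Matrix.toBlocks₁₁, Matrix.one_apply]
  rw [this]
  have h3 : φ.mapMatrix Z.toBlocks₁₁.toBlocks₁₁ = 1 := h1
  change φ.mapMatrix (1 - Z.toBlocks₁₁.toBlocks₁₁) = 0
  rw [map_sub, map_one, h3, sub_self]

theorem gammaMatrix_pow (h : GammaData p η₁ η₂ η₃ r₂ r₃) : gammaMatrix η₁ r₂ r₃ m ^ p = 1 := by
  have h0 : aeval (gammaMatrix η₁ r₂ r₃ m) ((X - 1) * η₁ * (η₂ * η₃)) = 0 := by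
    have hup : (aeval (Matrix.fromBlocks (Eₘ ⊗ₖ (1 : Matrix (Fin 1) (Fin 1) R)) 0 0
        (Eₘ ⊗ₖ companionMatrix η₁)) ((X - 1) * η₁)).map (RingHom.id R) = 0 := by
      rw [Matrix.aeval_fromBlocks_diagonal, map_mul, map_mul,
        aeval_one_kronecker_companionMatrix h, Matrix.one_kronecker_one]
      simp
    have := map_aeval_fromBlocks_eq_zero (RingHom.id R) (Matrix.fromBlocks
      (Eₘ ⊗ₖ rowU R η₁.natDegree) (jordanBlock R m 1 ⊗ₖ rowU R η₁.natDegree)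
      (Eₘ ⊗ₖ matUbar R η₁.natDegree) (Eₘ ⊗ₖ matUbar R η₁.natDegree)) hup
      (aeval_gammaMatrix_lower h)
    exact this
  obtain ⟨q, hq⟩ := h.dvd
  have h1 := congrArg (aeval (gammaMatrix η₁ r₂ r₃ m)) hq
  rw [map_mul, h0, zero_mul] at h1
  simpa [sub_eq_zero] using h1

/-- On the trivial block $\eta_1$ acts as the scalar $\eta_1(1)$, which is $0$ in $\kappa$; so
$\eta_1$ alone, without $X-1$, kills the upper half after reduction. -/
theorem map_aeval_gammaMatrix (h : GammaData p η₁ η₂ η₃ r₂ r₃) {κ : Type*} [Field κ]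
    (φ : R →+* κ) (hev : φ (η₁.eval 1) = 0) :
    (aeval (gammaMatrix η₁ r₂ r₃ m) (η₁ * (η₂ * η₃))).map φ = 0 := by
  refine map_aeval_fromBlocks_eq_zero φ _ ?_ (aeval_gammaMatrix_lower h)
  rw [Matrix.aeval_fromBlocks_diagonal, aeval_one_kronecker_companionMatrix h,
    Matrix.one_kronecker_one]
  have h1 : aeval (1 : Matrix (Fin m × Fin 1) (Fin m × Fin 1) R) η₁ =
      algebraMap R _ (η₁.eval 1) := by
    rw [← map_one (algebraMap R (Matrix (Fin m × Fin 1) (Fin m × Fin 1) R)),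
      aeval_algebraMap_apply_eq_algebraMap_eval]
  rw [h1, Matrix.fromBlocks_map]
  have h2 : (algebraMap R (Matrix (Fin m × Fin 1) (Fin m × Fin 1) R) (η₁.eval 1)).map φ = 0 := by
    ext i j
    simp [Matrix.algebraMap_matrix_apply, apply_ite φ, hev]
  rw [h2]
  simp [Matrix.map_zero φ (map_zero φ)]

end Commutant

/-- An idempotent criterion for the module of a representation of a cyclic group to be
indecomposable. -/
theorem isIndecomposableRep_of_idempotents {R G ι : Type*} [CommRing R] [Group G] [Nontrivial R]
    [Fintype ι] [DecidableEq ι] [Nonempty ι] (ρ : Representation R G (ι → R)) (a : G)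
    (M : Matrix ι ι R) (hM : ρ a = Matrix.toLin' M)
    (h : ∀ Z : Matrix ι ι R, Z * Z = Z → Z * M = M * Z → Z = 0 ∨ Z = 1) :
    IsIndecomposableRep ρ := by
  refine ⟨inferInstance, fun A B hA hB hAB => ?_⟩
  let e := A.projection B hAB
  have hcomm : e ∘ₗ ρ a = ρ a ∘ₗ e := by
    refine LinearMap.ext fun x => ?_
    obtain ⟨y, hy, z, hz, rfl⟩ := Submodule.mem_sup.1 (hAB.sup_eq_top ▸ Submodule.mem_top (x := x))
    have e1 : ∀ y ∈ A, e y = y := fun y hy => A.projection_apply_left hAB ⟨y, hy⟩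
    have e2 : ∀ z ∈ B, e z = 0 := fun z hz => A.projection_apply_right hAB ⟨z, hz⟩
    simp only [LinearMap.comp_apply, map_add]
    rw [e1 _ (hA a hy), e2 _ (hB a hz), e1 y hy, e2 z hz, map_zero]
  have hid : e ∘ₗ e = e := A.isIdempotentElem_projection hAB
  have hM' : LinearMap.toMatrix' (ρ a) = M := by rw [hM, LinearMap.toMatrix'_toLin']
  rcases h (LinearMap.toMatrix' e) (by rw [← LinearMap.toMatrix'_comp, hid])
    (by rw [← hM', ← LinearMap.toMatrix'_comp, hcomm, LinearMap.toMatrix'_comp]) with h0 | h1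
  · left
    have : e = 0 := by simpa using h0
    rw [← A.range_projection hAB]
    exact LinearMap.range_eq_bot.2 this
  · right
    have : e = LinearMap.id := by
      rw [← LinearMap.toMatrix'_id] at h1
      exact LinearMap.toMatrix'.injective h1
    rw [← A.ker_projection hAB]
    change LinearMap.ker e = ⊥
    rw [this, LinearMap.ker_id]

/-! ### Non-split cocycles -/

theorem extRep_tmul {R G M F : Type*} [CommRing R] [Group G] [Field F] [Algebra R F]
    [AddCommGroup M] [Module R M] (ρ : Representation R G M) (g : G) (c : F) (x : M) :
    extRep F ρ g (c ⊗ₜ[R] x) = c ⊗ₜ[R] ρ g x := by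
  simp [extRep]

/-- For a cyclic group of order `p` generated by `a`, an invariant vector which is not a norm gives
a class in `H¹(G, FM / M)` which does not vanish. -/
theorem exists_cocycle_of_not_norm {R G F M : Type u} [CommRing R] [Group G] [Field F]
    [Algebra R F] [FaithfulSMul R F] [AddCommGroup M] [Module R M] [Module.Free R M]
    (ρ : Representation R G M) {p : ℕ} (hpF : (p : F) ≠ 0) {a : G} (ha : orderOf a = p)
    (hG : ∀ g : G, g ∈ Subgroup.zpowers a) {w : M} (hw : ρ a w = w)
    (hN : ∀ y, ∑ i ∈ Finset.range p, ρ (a ^ i) y ≠ w) :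
    ∃ f : groupCohomology.cocycles₁ (Rep.of (hatRep F ρ)),
      groupCohomology.H1π (Rep.of (hatRep F ρ)) f ≠ 0 := by
  -- The class $q$ of $w/p$ is invariant and killed by $p$, so $a\mapsto q$ extends to a
  -- homomorphism with invariant values, which is a cocycle.
  let x : F ⊗[R] M := (p : F)⁻¹ ⊗ₜ[R] w
  have hpx : p • x = 1 ⊗ₜ[R] w := by
    rw [TensorProduct.smul_tmul', nsmul_eq_mul, mul_inv_cancel₀ hpF]
  let q : (F ⊗[R] M) ⧸ latticeInExt R M F := (latticeInExt R M F).mkQ x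
  have hpq : p • q = 0 := by
    rw [← map_nsmul, hpx]
    exact (Submodule.Quotient.mk_eq_zero _).2 ⟨w, rfl⟩
  have hinv : ∀ g, ρ g w = w := by
    let H : Subgroup G :=
      { carrier := {g | ρ g w = w}
        one_mem' := by simp
        mul_mem' := fun {g h} hg hh => by
          change ρ (g * h) w = w
          rw [map_mul, Module.End.mul_apply, show ρ h w = w from hh, show ρ g w = w from hg]
        inv_mem' := fun {g} hg => by
          change ρ g⁻¹ w = w
          conv_lhs => rw [← show ρ g w = w from hg]
          simp }
    intro g
    exact (Subgroup.zpowers_le.2 (show a ∈ H from hw)) (hG g)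
  have hinvx : ∀ g, extRep F ρ g x = x := fun g => by rw [extRep_tmul, hinv]
  have hinvq : ∀ g, hatRep F ρ g q = q := fun g =>
    congrArg (latticeInExt R M F).mkQ (hinvx g)
  have hord : orderOf (Multiplicative.ofAdd q) ∣ orderOf a := by
    rw [ha, orderOf_dvd_iff_pow_eq_one, ← ofAdd_nsmul, hpq, ofAdd_zero]
  let φ : G →* Multiplicative ((F ⊗[R] M) ⧸ latticeInExt R M F) :=
    monoidHomOfForallMemZpowers hG hord
  have hφa : φ a = Multiplicative.ofAdd q := monoidHomOfForallMemZpowers_apply_gen hG hord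
  have hφinv : ∀ g h, hatRep F ρ g (φ h).toAdd = (φ h).toAdd := by
    intro g h
    obtain ⟨i, rfl⟩ := hG h
    change hatRep F ρ g (φ (a ^ i)).toAdd = (φ (a ^ i)).toAdd
    rw [map_zpow, hφa, toAdd_zpow, toAdd_ofAdd, map_zsmul, hinvq]
  let f : groupCohomology.cocycles₁ (Rep.of (hatRep F ρ)) :=
    ⟨fun g => (φ g).toAdd, (groupCohomology.mem_cocycles₁_iff _).2 fun g h => by
      change (φ (g * h)).toAdd = hatRep F ρ g (φ h).toAdd + (φ g).toAdd
      rw [hφinv, map_mul, toAdd_mul, add_comm]⟩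
  refine ⟨f, fun h0 => ?_⟩
  obtain ⟨y, hy⟩ := (groupCohomology.H1π_eq_zero_iff f).1 h0
  have hya : hatRep F ρ a y - y = q := by
    have := congrFun hy a
    change hatRep F ρ a y - y = (φ a).toAdd at this
    rw [this, hφa, toAdd_ofAdd]
  obtain ⟨Y, rfl⟩ := (latticeInExt R M F).mkQ_surjective y
  have hmem : extRep F ρ a Y - Y - x ∈ latticeInExt R M F := by
    rw [← Submodule.Quotient.mk_eq_zero]
    change (latticeInExt R M F).mkQ (extRep F ρ a Y - Y - x) = 0
    rw [map_sub, map_sub, sub_eq_zero]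
    exact hya
  obtain ⟨w', hw'⟩ := hmem
  have hw'' : (1 : F) ⊗ₜ[R] w' = extRep F ρ a Y - Y - x := hw'
  -- Apply the norm to $w'=aY-Y-w/p$: the $Y$-terms telescope and the invariant term contributes
  -- $-w$, so $w$ is the norm of $-w'$.
  have hsum := congrArg (fun z => ∑ i ∈ Finset.range p, extRep F ρ (a ^ i) z) hw''
  simp only [map_sub, hinvx, extRep_tmul, Finset.sum_sub_distrib, Finset.sum_const,
    Finset.card_range] at hsum
  have htel : ∑ i ∈ Finset.range p, extRep F ρ (a ^ i) (extRep F ρ a Y) =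
      ∑ i ∈ Finset.range p, extRep F ρ (a ^ i) Y := by
    have h1 : ∀ i, extRep F ρ (a ^ i) (extRep F ρ a Y) = extRep F ρ (a ^ (i + 1)) Y := by
      intro i
      rw [pow_succ, map_mul, Module.End.mul_apply]
    rw [Finset.sum_congr rfl fun i _ => h1 i]
    have h2 := Finset.sum_range_succ (fun i => extRep F ρ (a ^ i) Y) p
    rw [Finset.sum_range_succ', ← ha, pow_orderOf_eq_one, pow_zero, ha] at h2
    exact add_right_cancel h2
  rw [htel, sub_self, zero_sub, hpx, ← TensorProduct.tmul_sum] at hsum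
  refine hN (-w') (Module.Flat.tensorProduct_mk_injective R M F ?_)
  change (1 : F) ⊗ₜ[R] _ = (1 : F) ⊗ₜ[R] w
  rw [Finset.sum_congr rfl fun i _ => map_neg (ρ (a ^ i)) w', Finset.sum_neg_distrib,
    TensorProduct.tmul_neg, hsum, neg_neg]

/-! ### The representations `Γ_m` -/

section GammaRepresentation

variable {R : Type*} [CommRing R] {G : Type*} [Group G] {a : G}

/-- The representation of a cyclic group defined by the image of a generator. -/
theorem exists_representation_of_pow_eq_one {M : Type*} [AddCommGroup M] [Module R M] {p : ℕ}
    (hp : p ≠ 0) (ha : orderOf a = p) (hG : ∀ g : G, g ∈ Subgroup.zpowers a)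
    (t : Module.End R M) (ht : t ^ p = 1) : ∃ ρ : Representation R G M, ρ a = t := by
  let t' : (Module.End R M)ˣ := Units.ofPowEqOne t p ht hp
  have hord : orderOf t' ∣ orderOf a := by
    rw [ha, orderOf_dvd_iff_pow_eq_one]
    exact Units.pow_ofPowEqOne ht hp
  refine ⟨(Units.coeHom _).comp (monoidHomOfForallMemZpowers hG hord), ?_⟩
  rw [MonoidHom.comp_apply, monoidHomOfForallMemZpowers_apply_gen hG hord]
  rfl

/-- In characteristic $p$ one has $(x-1)^p=x^p-1$. -/
theorem isNilpotent_of_pow_char_eq_one {κ S : Type*} [Field κ] [Ring S] [Algebra κ S] (p : ℕ)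
    [Fact p.Prime] [CharP κ p] {x : S} (hx : x ^ p = 1) : IsNilpotent (x - 1) := by
  refine ⟨p, ?_⟩
  have h : (X - 1 : κ[X]) ^ p = X ^ p - 1 := by rw [sub_pow_char, one_pow]
  have := congrArg (aeval x) h
  simpa [hx] using this

end GammaRepresentation

/-- `Γ_m` is an indecomposable representation of the cyclic group of order `p`, and some 1-cocycle
with values in `FM / M` is not cohomologous to zero. -/
theorem exists_indecomposable_gamma {R G F : Type u} [CommRing R] [IsDomain R] [Group G] [Field F]
    [Algebra R F] [FaithfulSMul R F] {p : ℕ} [Fact p.Prime] (hpR : (p : R) ≠ 0)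
    {a : G} (ha : orderOf a = p) (hG : ∀ g : G, g ∈ Subgroup.zpowers a)
    {η₁ η₂ η₃ : R[X]} {r₂ r₃ : ℕ} (h : GammaData p η₁ η₂ η₃ r₂ r₃)
    (hcyc : η₁ * (η₂ * η₃) ∣ cyclotomic p R)
    {κ : Type*} [Field κ] [CharP κ p] (φ : R →+* κ) (hev : φ (η₁.eval 1) = 0)
    {m : ℕ} (hm : 1 ≤ m) :
    ∃ Γ : Representation R G (GammaIndex m η₁.natDegree → R),
      Γ a = Matrix.toLin' (gammaMatrix η₁ r₂ r₃ m) ∧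
      Module.finrank R (GammaIndex m η₁.natDegree → R) = (3 * η₁.natDegree + 1) * m ∧
      IsIndecomposableRep Γ ∧
      ∃ f : groupCohomology.cocycles₁ (Rep.of (hatRep F Γ)),
        groupCohomology.H1π (Rep.of (hatRep F Γ)) f ≠ 0 := by
  have hp : p.Prime := Fact.out
  obtain ⟨Γ, hΓ⟩ := exists_representation_of_pow_eq_one (R := R) hp.ne_zero ha hG
    (Matrix.toLin' (gammaMatrix η₁ r₂ r₃ m)) (by
      rw [← Matrix.toLin'_pow, gammaMatrix_pow h, Matrix.toLin'_one]
      rfl)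
  let o : GammaIndex m η₁.natDegree := Sum.inl (Sum.inl (⟨0, hm⟩, 0))
  have hnil : IsNilpotent ((companionMatrix η₁).map φ - 1) := by
    refine isNilpotent_of_pow_char_eq_one (κ := κ) p ?_
    rw [← Matrix.map_pow_ringHom, companionMatrix_pow_eq_one h, Matrix.map_one_ringHom]
  refine ⟨Γ, hΓ, ?_, ?_, ?_⟩
  · simp only [Module.finrank_fintype_fun_eq_card, Fintype.card_sum, Fintype.card_prod,
      Fintype.card_fin]
    ring
  · have : Nonempty (GammaIndex m η₁.natDegree) := ⟨o⟩
    exact isIndecomposableRep_of_idempotents Γ a _ hΓ fun Z h1 h2 =>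
      eq_zero_or_one_of_idempotent_of_commute hp.one_lt hpR h φ hev hnil h1 h2
  · have hpF : (p : F) ≠ 0 := by
      rw [← map_natCast (algebraMap R F)]
      exact (map_ne_zero_iff _ (FaithfulSMul.algebraMap_injective R F)).2 hpR
    refine exists_cocycle_of_not_norm Γ hpF ha hG (w := Pi.single o 1) ?_ fun y hy => ?_
    · rw [hΓ, Matrix.toLin'_apply, Matrix.mulVec_single_one]
      ext i
      rw [Matrix.col_apply]
      rcases i with (⟨i, i'⟩ | i) | (i | i) <;>
        simp [gammaMatrix, o, Pi.single_apply, Matrix.one_apply, Prod.ext_iff, Fin.ext_iff]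
    · have hnorm : ∑ i ∈ Finset.range p, Γ (a ^ i) y =
          (aeval (gammaMatrix η₁ r₂ r₃ m) (cyclotomic p R)).mulVec y := by
        rw [cyclotomic_prime, map_sum, Matrix.sum_mulVec]
        refine Finset.sum_congr rfl fun i _ => ?_
        rw [map_pow, hΓ, ← Matrix.toLin'_pow, Matrix.toLin'_apply, map_pow, aeval_X]
      obtain ⟨q, hq⟩ := hcyc
      -- The norm element acts as $\Phi_p(\Gamma)$, a multiple of $(\eta_1\eta_2\eta_3)(\Gamma)$, so
      -- every norm reduces to $0$. The coordinate $1$ of $w$ at `o` contradicts this.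
      have hzero : (aeval (gammaMatrix η₁ r₂ r₃ m) (cyclotomic p R)).map φ = 0 := by
        rw [hq, map_mul, Matrix.map_mul, map_aeval_gammaMatrix h φ hev, Matrix.zero_mul]
      rw [hnorm] at hy
      have h1 := congrArg φ (congrFun hy o)
      rw [Pi.single_eq_same, map_one, Matrix.mulVec, dotProduct, map_sum,
        Finset.sum_eq_zero fun j _ => ?_] at h1
      · exact zero_ne_one h1
      · rw [map_mul, show φ _ = 0 from congrFun (congrFun hzero o) j, zero_mul]

/-! ### The ring of integers of a finite extension of `ℚ_[p]` -/

theorem isIntegrallyClosed_of_isIntegralClosure_padicInt (p : ℕ) [Fact p.Prime]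
    (T : Type*) [Field T] [Algebra ℚ_[p] T] [FiniteDimensional ℚ_[p] T] [Algebra ℤ_[p] T]
    [IsScalarTower ℤ_[p] ℚ_[p] T] (R : Type*) [CommRing R] [Algebra R T]
    [IsIntegralClosure R ℤ_[p] T] : IsIntegrallyClosed R := by
  have : IsIntegrallyClosed (integralClosure ℤ_[p] T) :=
    integralClosure.isIntegrallyClosedOfFiniteExtension ℚ_[p]
  let f : R →+* integralClosure ℤ_[p] T := (algebraMap R T).codRestrict _ fun x =>
    (IsIntegralClosure.isIntegral_iff (R := ℤ_[p]) (A := R)).2 ⟨x, rfl⟩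
  have hf : Function.Bijective f := by
    refine ⟨fun x y hxy => IsIntegralClosure.algebraMap_injective R ℤ_[p] T ?_, fun y => ?_⟩
    · exact congrArg Subtype.val hxy
    · obtain ⟨x, hx⟩ := (IsIntegralClosure.isIntegral_iff (A := R)).1 y.2
      exact ⟨x, Subtype.ext hx⟩
  exact IsIntegrallyClosed.of_equiv (RingEquiv.ofBijective f hf).symm

/-- Otherwise $1/p$ would be integral over $\mathbb Z_p$, hence in $\mathbb Z_p$, although its norm
is $p>1$. -/
theorem not_isUnit_natCast_of_isIntegralClosure_padicInt (p : ℕ) [Fact p.Prime]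
    (T : Type*) [Field T] [Algebra ℚ_[p] T] [Algebra ℤ_[p] T]
    [IsScalarTower ℤ_[p] ℚ_[p] T] (R : Type*) [CommRing R] [Algebra R T]
    [IsIntegralClosure R ℤ_[p] T] : ¬ IsUnit (p : R) := by
  intro hu
  obtain ⟨r, hr⟩ := hu.exists_right_inv
  have hint : IsIntegral ℤ_[p] (algebraMap R T r) :=
    (IsIntegralClosure.isIntegral_iff (A := R)).2 ⟨r, rfl⟩
  have hr' : algebraMap R T r = algebraMap ℚ_[p] T (p : ℚ_[p])⁻¹ := by
    have h1 := congrArg (algebraMap R T) hr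
    rw [map_mul, map_natCast, map_one] at h1
    rw [map_inv₀, map_natCast]
    exact eq_inv_of_mul_eq_one_right h1
  rw [hr', isIntegral_algebraMap_iff (algebraMap ℚ_[p] T).injective] at hint
  obtain ⟨x, hx⟩ := IsIntegrallyClosed.isIntegral_iff.1 hint
  have h2 : ‖(p : ℚ_[p])⁻¹‖ ≤ 1 := hx ▸ x.2
  rw [norm_inv, Padic.norm_p, inv_inv] at h2
  have : 1 < (p : ℝ) := mod_cast (Fact.out : p.Prime).one_lt
  linarith

/-! ### Roots of the factors of a cyclotomic polynomial -/

/-- Over an integrally closed domain the minimal polynomial of $\varepsilon$ divides every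
polynomial vanishing there, and the irreducible $f$ is associated to it. -/
theorem dvd_of_irreducible_of_monic_of_root {R K : Type*} [CommRing R] [IsDomain R]
    [IsIntegrallyClosed R] [Field K] [Algebra R K] [Module.IsTorsionFree R K] {f g : R[X]} {ε : K}
    (hf : Irreducible f) (hfm : f.Monic) (hfε : aeval ε f = 0) (hgε : aeval ε g = 0) : f ∣ g := by
  have hint : IsIntegral R ε := ⟨f, hfm, hfε⟩
  have h1 := minpoly.isIntegrallyClosed_dvd hint hfε
  exact ((hf.dvd_iff.1 h1).resolve_left (minpoly.not_isUnit R ε)).dvd.trans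
    (minpoly.isIntegrallyClosed_dvd hint hgε)

/-- If $p\mid r$ then $\varepsilon^r=1$ is a root of $f$, so $p=\Phi_p(1)=0$. -/
theorem coprime_of_aeval_pow_eq_zero {R K : Type*} [CommRing R] [Field K] [Algebra R K]
    [FaithfulSMul R K] {p : ℕ} [Fact p.Prime] (hpR : (p : R) ≠ 0) {f : R[X]}
    (hf : f ∣ cyclotomic p R) {ε : K} (hε : ε ^ p = 1) {r : ℕ} (h : aeval (ε ^ r) f = 0) :
    r.Coprime p := by
  refine (((Fact.out : p.Prime).coprime_iff_not_dvd).2 ?_).symm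
  rintro ⟨s, rfl⟩
  rw [pow_mul, hε, one_pow] at h
  obtain ⟨g, hg⟩ := hf
  have h1 := congrArg (aeval (1 : K)) hg
  rw [map_mul, h, zero_mul, ← map_one (algebraMap R K), aeval_algebraMap_apply_eq_algebraMap_eval,
    eval_one_cyclotomic_prime] at h1
  exact hpR ((map_eq_zero_iff _ (FaithfulSMul.algebraMap_injective R K)).1 h1)

theorem gammaData_of_isPrimitiveRoot {R K : Type*} [CommRing R] [IsDomain R]
    [IsIntegrallyClosed R] [Field K] [Algebra R K] [FaithfulSMul R K] {p : ℕ} [Fact p.Prime]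
    (hpR : (p : R) ≠ 0) {η₁ η₂ η₃ : R[X]} (hm : η₁.Monic) (hi : Irreducible η₁)
    (hdvd : η₁ * (η₂ * η₃) ∣ cyclotomic p R) {ε : K} (hε : ε ^ p = 1)
    (h₁ : aeval ε η₁ = 0) {r₂ r₃ : ℕ} (h₂ : aeval (ε ^ r₂) η₂ = 0) (h₃ : aeval (ε ^ r₃) η₃ = 0) :
    GammaData p η₁ η₂ η₃ r₂ r₃ := by
  have : Module.IsTorsionFree R K := inferInstance
  have hroot : ∀ {η : R[X]} {r : ℕ}, aeval (ε ^ r) η = 0 →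
      aeval (companionMatrix η₁ ^ r) η = 0 := by
    intro η r h
    -- The relation at the root $\varepsilon$ passes to the companion matrix, since $\eta_1$ divides
    -- $\eta(X^r)$ and annihilates that matrix.
    have hd : η₁ ∣ η.comp (X ^ r) := dvd_of_irreducible_of_monic_of_root hi hm h₁ (by
      rw [aeval_comp, map_pow, aeval_X, h])
    obtain ⟨q, hq⟩ := hd
    have h1 := congrArg (aeval (companionMatrix η₁)) hq
    rwa [map_mul, aeval_companionMatrix hm, zero_mul, aeval_comp, map_pow, aeval_X] at h1
  refine ⟨hm, hm.natDegree_pos_of_not_isUnit hi.not_isUnit, ?_, hroot h₂, hroot h₃, ?_, ?_⟩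
  · rw [mul_assoc, ← cyclotomic_prime_mul_X_sub_one R p, mul_comm (cyclotomic p R)]
    exact mul_dvd_mul_left _ hdvd
  · exact coprime_of_aeval_pow_eq_zero hpR
      (((dvd_mul_right η₂ η₃).trans (dvd_mul_left _ η₁)).trans hdvd) hε h₂
  · exact coprime_of_aeval_pow_eq_zero hpR
      (((dvd_mul_left η₃ η₂).trans (dvd_mul_left _ η₁)).trans hdvd) hε h₃

/-- Over $\kappa$ the image of $f$ divides $(X-1)^p$ and still has positive degree, so it is
divisible by $X-1$. -/
theorem map_eval_one_eq_zero_of_dvd_cyclotomic {R κ : Type*} [CommRing R] [Field κ] {p : ℕ}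
    [Fact p.Prime] [CharP κ p] (φ : R →+* κ) {f : R[X]} (hm : f.Monic) (hd : 0 < f.natDegree)
    (hf : f ∣ cyclotomic p R) : φ (f.eval 1) = 0 := by
  have h1 : f.map φ ∣ (X - C (1 : κ)) ^ p := by
    rw [C_1, sub_pow_char, one_pow, ← cyclotomic_prime_mul_X_sub_one κ p, ← map_cyclotomic p φ]
    exact (Polynomial.map_dvd φ hf).mul_right _
  obtain ⟨i, -, hi⟩ := (dvd_prime_pow (prime_X_sub_C (1 : κ)) p).1 h1
  have hi0 : i ≠ 0 := by
    rintro rfl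
    rw [pow_zero, associated_one_iff_isUnit] at hi
    have := natDegree_eq_zero_of_isUnit hi
    rw [hm.natDegree_map] at this
    omega
  have h2 : X - C (1 : κ) ∣ f.map φ := (dvd_pow_self _ hi0).trans hi.symm.dvd
  rw [dvd_iff_isRoot, IsRoot.def, eval_map, ← map_one φ, eval₂_at_apply] at h2
  exact h2

end

/-! ### Proof of the theorem -/

theorem theorem4 (p : ℕ) [Fact p.Prime]
    (T : Type*) [Field T] [Algebra ℚ_[p] T] [FiniteDimensional ℚ_[p] T]
    [Algebra ℤ_[p] T] [IsScalarTower ℤ_[p] ℚ_[p] T]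
    (R : Type u) [CommRing R] [Algebra R T] [IsIntegralClosure R ℤ_[p] T]
    (F : Type u) [Field F] [Algebra R F] [FaithfulSMul R F]
    (G : Type u) [Group G] (a : G) (ha : orderOf a = p) (hG : ∀ g : G, g ∈ Subgroup.zpowers a)
    (k : ℕ) (hk : 3 ≤ k) (η : ℕ → R[X])
    (hmonic : ∀ j ∈ Finset.Icc 1 k, (η j).Monic)
    (hirr : ∀ j ∈ Finset.Icc 1 k, Irreducible (η j))
    (hprod : cyclotomic p R = ∏ j ∈ Finset.Icc 1 k, η j) :
    (¬ BddAbove {d : ℕ | ∃ c : CrysDatum R G F, c.IsNonSplit ∧ c.IsIndecomposable ∧ c.dim = d}) ∧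
    ∀ (ε : AlgebraicClosure T), IsPrimitiveRoot ε p → aeval ε (η 1) = 0 →
      ∀ r₂ r₃ : ℕ, aeval (ε ^ r₂) (η 2) = 0 → aeval (ε ^ r₃) (η 3) = 0 →
        ∀ m : ℕ, 1 ≤ m →
          ∃ Γ : Representation R G (GammaIndex m (η 1).natDegree → R),
            Γ a = Matrix.toLin' (gammaMatrix (η 1) r₂ r₃ m) ∧
            Module.finrank R (GammaIndex m (η 1).natDegree → R) = (3 * (η 1).natDegree + 1) * m ∧
            IsIndecomposableRep Γ ∧
            Nontrivial (groupCohomology.H1 (Rep.of (hatRep F Γ))) := by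
  have hp : p.Prime := Fact.out
  have hinjT : Function.Injective (algebraMap R T) :=
    IsIntegralClosure.algebraMap_injective R ℤ_[p] T
  have : IsDomain R := hinjT.isDomain _
  have : IsIntegrallyClosed R := isIntegrallyClosed_of_isIntegralClosure_padicInt p T R
  have hinjK : Function.Injective (algebraMap R (AlgebraicClosure T)) := by
    rw [IsScalarTower.algebraMap_eq R T (AlgebraicClosure T)]
    exact (algebraMap T (AlgebraicClosure T)).injective.comp hinjT
  have : FaithfulSMul R (AlgebraicClosure T) := (faithfulSMul_iff_algebraMap_injective _ _).2 hinjK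
  have hpR : (p : R) ≠ 0 := by
    have hpT : (p : T) ≠ 0 := by
      rw [← map_natCast (algebraMap ℚ_[p] T)]
      exact (_root_.map_ne_zero _).2 (Nat.cast_ne_zero.2 hp.ne_zero)
    rw [← map_natCast (algebraMap R T)] at hpT
    exact fun h => hpT (by rw [h, map_zero])
  have hmem : ∀ j, 1 ≤ j → j ≤ 3 → j ∈ Finset.Icc 1 k := fun j h1 h2 =>
    Finset.mem_Icc.2 ⟨h1, h2.trans hk⟩
  have hdvd : η 1 * (η 2 * η 3) ∣ cyclotomic p R := by
    have h1 : ∏ j ∈ ({1, 2, 3} : Finset ℕ), η j ∣ ∏ j ∈ Finset.Icc 1 k, η j := by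
      refine Finset.prod_dvd_prod_of_subset _ _ _ fun j hj => ?_
      simp only [Finset.mem_insert, Finset.mem_singleton] at hj
      exact hmem j (by omega) (by omega)
    rw [hprod]
    simpa using h1
  have hdvd₁ : η 1 ∣ cyclotomic p R := (dvd_mul_right _ _).trans hdvd
  have hdeg : ∀ j, 1 ≤ j → j ≤ 3 → 0 < (η j).natDegree := fun j h1 h2 =>
    (hmonic j (hmem j h1 h2)).natDegree_pos_of_not_isUnit (hirr j (hmem j h1 h2)).not_isUnit
  -- Any maximal ideal containing the non-unit $p$ supplies a residue field of characteristic $p$.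
  obtain ⟨𝔪, h𝔪, hp𝔪⟩ := exists_max_ideal_of_mem_nonunits
    (mem_nonunits_iff.2 (not_isUnit_natCast_of_isIntegralClosure_padicInt p T R))
  let : Field (R ⧸ 𝔪) := Ideal.Quotient.field 𝔪
  have hpκ : (p : R ⧸ 𝔪) = 0 := by
    rw [← map_natCast (Ideal.Quotient.mk 𝔪)]
    exact Ideal.Quotient.eq_zero_iff_mem.2 hp𝔪
  have : CharP (R ⧸ 𝔪) p := (CharP.charP_iff_prime_eq_zero hp).2 hpκ
  have hev := map_eval_one_eq_zero_of_dvd_cyclotomic (Ideal.Quotient.mk 𝔪)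
    (hmonic 1 (hmem 1 le_rfl (by norm_num))) (hdeg 1 le_rfl (by norm_num)) hdvd₁
  have main : ∀ (ε : AlgebraicClosure T), ε ^ p = 1 → aeval ε (η 1) = 0 →
      ∀ r₂ r₃ : ℕ, aeval (ε ^ r₂) (η 2) = 0 → aeval (ε ^ r₃) (η 3) = 0 → ∀ m : ℕ, 1 ≤ m → _ :=
    fun ε hε h₁ r₂ r₃ h₂ h₃ m hm => exists_indecomposable_gamma (F := F) hpR ha hG
      (gammaData_of_isPrimitiveRoot hpR (hmonic 1 (hmem 1 le_rfl (by norm_num)))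
        (hirr 1 (hmem 1 le_rfl (by norm_num))) hdvd hε h₁ h₂ h₃) hdvd (Ideal.Quotient.mk 𝔪) hev hm
  constructor
  · have : NeZero (p : AlgebraicClosure T) := ⟨by
      rw [← map_natCast (algebraMap R (AlgebraicClosure T))]
      exact (map_ne_zero_iff _ hinjK).2 hpR⟩
    -- Part (a) needs actual exponents: every root of $\eta_j$ is a primitive $p$-th root of unity,
    -- so the roots chosen for $\eta_2,\eta_3$ are powers of $\varepsilon$.
    have hroot : ∀ j, 1 ≤ j → j ≤ 3 → ∃ ζ : AlgebraicClosure T, aeval ζ (η j) = 0 ∧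
        IsPrimitiveRoot ζ p := by
      intro j h1 h2
      obtain ⟨ζ, hζ⟩ := IsAlgClosed.exists_eval₂_eq_zero_of_injective
        (algebraMap R (AlgebraicClosure T)) hinjK (η j)
        (natDegree_pos_iff_degree_pos.1 (hdeg j h1 h2)).ne'
      refine ⟨ζ, hζ, ?_⟩
      rw [← isRoot_cyclotomic_iff, ← map_cyclotomic p (algebraMap R (AlgebraicClosure T)),
        IsRoot.def, eval_map, hprod, eval₂_finsetProd]
      exact Finset.prod_eq_zero (hmem j h1 h2) hζ
    obtain ⟨ε, hε, hεp⟩ := hroot 1 le_rfl (by norm_num)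
    obtain ⟨ζ₂, h₂, hp₂⟩ := hroot 2 (by norm_num) (by norm_num)
    obtain ⟨ζ₃, h₃, hp₃⟩ := hroot 3 (by norm_num) le_rfl
    obtain ⟨r₂, -, rfl⟩ := hεp.eq_pow_of_pow_eq_one hp₂.pow_eq_one
    obtain ⟨r₃, -, rfl⟩ := hεp.eq_pow_of_pow_eq_one hp₃.pow_eq_one
    rintro ⟨B, hB⟩
    -- Taking $m=B+1$ makes the degree $(3n+1)m$ exceed the supposed bound $B$.
    obtain ⟨Γ, -, hrank, hind, f, hf⟩ :=
      main ε hεp.pow_eq_one hε r₂ r₃ h₂ h₃ (B + 1) (Nat.le_add_left 1 B)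
    have hle := hB (a := (3 * (η 1).natDegree + 1) * (B + 1)) ⟨⟨_, Γ, f⟩, hf, ⟨hind, hf⟩, hrank⟩
    have : B + 1 ≤ (3 * (η 1).natDegree + 1) * (B + 1) := Nat.le_mul_of_pos_left _ (by omega)
    omega
  · intro ε hε h₁ r₂ r₃ h₂ h₃ m hm
    obtain ⟨Γ, hΓ, hrank, hind, f, hf⟩ := main ε hε.pow_eq_one h₁ r₂ r₃ h₂ h₃ m hm
    exact ⟨Γ, hΓ, hrank, hind, ⟨_, 0, hf⟩⟩
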